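/- Let $\mathbb K$ be a field of characteristic zero, let $U$ be a $\mathbb K$-vector space of finite dimension $r\ge 1$, and let $X=(x_1,\ldots,x_N)$ be a finite sequence of vectors spanning $U$. Subsequences of $X$ are identified with sets of indices (repetitions and zero vectors are allowed), and $X$ carries a fixed linear order of its elements. Consider the matroid of $X$ given by linear independence, with closure operator $\operatorname{clos}$, set of bases $\mathbb B(X)$ and lattice of flats $\mathcal L(X)$. Let $J\subseteq\mathcal L(X)$ be a non-empty upper set, and for $A\subseteq X$ put $\chi(A)=1$ if $\operatorname{clos}(A)\in J$ and $\chi(A)=0$ otherwise. In the symmetric algebra $\operatorname{Sym}(U)$ with its natural grading, write $p_Y=\prod_{x\in Y}x$ for $Y\subseteq X$. Let $\mathcal P(X,0,J)=\operatorname{span}\{p_Y : Y\subseteq X,\ \operatorname{clos}(X\setminus Y)\in J\}$ and, for $k\ge1$, $\mathcal P(X,k,J)=\operatorname{span}\{f\,p_Y : Y\subseteq X,\ f\in\operatorname{Sym}(U),\ 0\le\deg f\le\chi(X\setminus Y)+k-1\}$. For a graded subspace $P=\bigoplus_i P_i$ of $\operatorname{Sym}(U)$ let $\operatorname{Hilb}(P,t)=\sum_{i\ge0}\dim(P_i)\,t^i$.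 For a basis $B\in\mathbb B(X)$, an element $b\in B$ is internally active if $b=\max(X\setminus\operatorname{clos}(B\setminus b))$, and $x\in X\setminus B$ is externally active if $x\in\operatorname{clos}\{b\in B: b\le x\}$. Let $I(B)$ and $E(B)$ denote the sets of internally and externally active elements with respect to $B$. Then for every integer $k\ge 0$, $\mathcal P(X,k,J)$ is a graded subspace of $\operatorname{Sym}(U)$ and $$\operatorname{Hilb}(\mathcal P(X,k,J),t)=\sum_{B\in\mathbb B(X)}t^{N-r-|E(B)|}\Biggl(1+\sum_{\emptyset\ne I\subseteq I(B)}\ \sum_{j=0}^{\chi((B\cup E(B))\setminus I)+k-1}t^{|I|+j}\binom{j+|I|-1}{|I|-1}\Biggr),$$ where a sum with upper limit $-1$ is empty. For $k=0$ this specializes to $$\operatorname{Hilb}(\mathcal P(X,0,J),t)=\sum_{B\in\mathbb B(X)}t^{N-r-|E(B)|}\Biggl(1+\sum_{\substack{\emptyset\ne I\subseteq I(B)\\ \chi((B\cup E(B))\setminus I)=1}}t^{|I|}\Biggr).$$ -/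

import Mathlib

namespace Zonotopal

open scoped Classical

noncomputable section

universe u v w

variable {K : Type u} [Field K] {U : Type v} [AddCommGroup U] [Module K U]
variable {ι : Type w}

/-! ### The matroid of a finite sequence of vectors -/

/-- The linear matroid of a finite family of vectors `x : ι → U`: its ground set is the whole
index set, and a set of indices is independent when the corresponding subfamily is linearly
independent. -/
def linearMatroid (K : Type u) [Field K] {U : Type v} [AddCommGroup U] [Module K U]
    {ι : Type w} [Finite ι] (x : ι → U) : Matroid ι :=
  (IndepMatroid.ofFinite (E := Set.univ) Set.finite_univ (fun I => LinearIndepOn K x I)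
    (linearIndepOn_empty K x)
    (fun _ _ hJ hIJ => hJ.mono hIJ)
    (by
      intro I J hI hJ hlt
      by_contra! hcon
      have hsub : Submodule.span K (x '' J) ≤ Submodule.span K (x '' I) := by
        rw [Submodule.span_le]
        rintro _ ⟨e, he, rfl⟩
        by_cases heI : e ∈ I
        · exact Submodule.subset_span ⟨e, heI, rfl⟩
        · by_contra hns
          exact hcon e he heI (hI.insert hns)
      have hfin : FiniteDimensional K (Submodule.span K (x '' I)) :=
        FiniteDimensional.span_of_finite K (Set.toFinite _)
      have hle := Submodule.finrank_mono hsub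
      have card : ∀ S : Set ι, LinearIndepOn K x S →
          Module.finrank K (Submodule.span K (x '' S)) = S.ncard := by
        intro S hS
        have := Fintype.ofFinite S
        have h := finrank_span_eq_card (R := K) (b := fun i : S => x i) hS
        rw [← Nat.card_eq_fintype_card, Nat.card_coe_set_eq] at h
        rw [← h, Set.image_eq_range]
      rw [card J hJ, card I hI] at hle
      omega)
    (fun _ _ => Set.subset_univ _)).matroid

theorem linearMatroid_ground [Finite ι] (x : ι → U) : (linearMatroid K x).E = Set.univ := rfl

theorem linearMatroid_indep_iff [Finite ι] (x : ι → U) (I : Set ι) :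
    (linearMatroid K x).Indep I ↔ LinearIndepOn K x I := Iff.rfl

/-- The closure of a set of indices consists of the vectors in the span. -/
theorem mem_closure_linearMatroid_iff [Finite ι] (x : ι → U) (A : Set ι) (i : ι) :
    i ∈ (linearMatroid K x).closure A ↔ x i ∈ Submodule.span K (x '' A) := by
  obtain ⟨I, hI⟩ := (linearMatroid K x).exists_isBasis A (Set.subset_univ _)
  have hIi : LinearIndepOn K x I := hI.indep
  have hspan : Submodule.span K (x '' I) = Submodule.span K (x '' A) := by
    apply le_antisymm (Submodule.span_mono (Set.image_mono hI.subset))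
    rw [Submodule.span_le]
    rintro _ ⟨e, he, rfl⟩
    by_contra hns
    have heI : e ∉ I := fun h => hns (Submodule.subset_span ⟨e, h, rfl⟩)
    exact heI (hI.mem_of_insert_indep he (hIi.insert hns))
  rw [← hI.closure_eq_closure, hI.indep.mem_closure_iff', ← hspan]
  constructor
  · rintro ⟨-, h⟩
    by_contra hns
    exact hns (Submodule.subset_span ⟨i, h (hIi.insert hns), rfl⟩)
  · intro h
    refine ⟨Set.mem_univ _, fun hins => ?_⟩
    by_contra hiI
    exact ((linearIndepOn_insert hiI).1 hins).2 h

section Matroid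

variable [Finite ι]

/-- The lattice of flats of the matroid of `x`, ordered by inclusion (as a subtype of sets). -/
abbrev Flats (K : Type u) [Field K] {U : Type v} [AddCommGroup U] [Module K U]
    {ι : Type w} [Finite ι] (x : ι → U) : Type w :=
  {F : Set ι // (linearMatroid K x).IsFlat F}

/-- The closure of a subsequence, as a flat. -/
def clos (K : Type u) [Field K] {U : Type v} [AddCommGroup U] [Module K U]
    {ι : Type w} [Finite ι] (x : ι → U) (A : Set ι) : Flats K x :=
  ⟨(linearMatroid K x).closure A, (linearMatroid K x).isFlat_closure A⟩

/-- The indicator function of `J`, extended to all subsequences by `χ(A) = χ(clos A)`. -/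
def chi {x : ι → U} (J : Set (Flats K x)) (A : Set ι) : ℕ :=
  if clos K x A ∈ J then 1 else 0

end Matroid

section Activity

variable [Fintype ι]

/-- The set of bases of the matroid of `x`. -/
def bases (K : Type u) [Field K] {U : Type v} [AddCommGroup U] [Module K U]
    {ι : Type w} [Fintype ι] (x : ι → U) : Finset (Finset ι) :=
  Finset.univ.filter fun B => (linearMatroid K x).IsBase (B : Set ι)

/-- Internally active elements of `B`: those `b ∈ B` with `b = max (X \ clos (B \ b))`. -/
def internallyActive (K : Type u) [Field K] {U : Type v} [AddCommGroup U] [Module K U]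
    {ι : Type w} [Fintype ι] [LinearOrder ι] (x : ι → U) (B : Finset ι) : Finset ι :=
  B.filter fun b => IsGreatest ((linearMatroid K x).closure ((B : Set ι) \ {b}))ᶜ b

/-- Externally active elements with respect to `B`: those `e ∉ B` with
`e ∈ clos {b ∈ B : b ≤ e}`. -/
def externallyActive (K : Type u) [Field K] {U : Type v} [AddCommGroup U] [Module K U]
    {ι : Type w} [Fintype ι] [LinearOrder ι] (x : ι → U) (B : Finset ι) : Finset ι :=
  Finset.univ.filter fun e => e ∉ B ∧ e ∈ (linearMatroid K x).closure {b | b ∈ B ∧ b ≤ e}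

end Activity

/-! ### The symmetric algebra and its grading -/

/-- The degree `i` component of `Sym(U)`: the span of all products of `i` vectors of `U`. -/
def symDegree (K : Type u) [Field K] (U : Type v) [AddCommGroup U] [Module K U] (i : ℕ) :
    Submodule K (SymmetricAlgebra K U) :=
  LinearMap.range (SymmetricAlgebra.ι K U) ^ i

/-- The elements of `Sym(U)` of degree at most `d` (together with `0`). -/
def symDegreeLE (K : Type u) [Field K] (U : Type v) [AddCommGroup U] [Module K U] (d : ℕ) :
    Submodule K (SymmetricAlgebra K U) :=
  ⨆ i ∈ Finset.range (d + 1), symDegree K U i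

/-- The degree `i` component of a subspace of `Sym(U)`. -/
def gradedPart (P : Submodule K (SymmetricAlgebra K U)) (i : ℕ) :
    Submodule K (SymmetricAlgebra K U) :=
  P ⊓ symDegree K U i

/-- `P` is a graded subspace of `Sym(U)`: it is the internal direct sum of its components. -/
def IsGradedSubspace (P : Submodule K (SymmetricAlgebra K U)) : Prop :=
  DirectSum.IsInternal fun i : ℕ => (gradedPart P i).submoduleOf P

/-- The Hilbert series of a graded subspace of `Sym(U)`. -/
def hilb (P : Submodule K (SymmetricAlgebra K U)) : PowerSeries ℕ :=
  PowerSeries.mk fun i => Module.finrank K (gradedPart P i)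

/-! ### The space `P(X, k, J)` for `k ≥ 0` -/

/-- The product `p_Y` of the vectors of a subsequence `Y`, taken in `Sym(U)`. -/
def pProd (K : Type u) [Field K] {U : Type v} [AddCommGroup U] [Module K U]
    {ι : Type w} (x : ι → U) (Y : Finset ι) : SymmetricAlgebra K U :=
  ∏ i ∈ Y, SymmetricAlgebra.ι K U (x i)

/-- The generating set `S(X, k, J)` for `k ≥ 0`. For `k = 0` it consists of the `p_Y` with
`clos (X \ Y) ∈ J`; for `k = n + 1` of the `f p_Y` with `0 ≤ deg f ≤ χ(X \ Y) + n`. -/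
def spanningSet [Finite ι] {x : ι → U} (J : Set (Flats K x)) :
    ℕ → Set (SymmetricAlgebra K U)
  | 0 => {q | ∃ Y : Finset ι, clos K x ((Y : Set ι)ᶜ) ∈ J ∧ q = pProd K x Y}
  | n + 1 => {q | ∃ (Y : Finset ι) (f : SymmetricAlgebra K U), f ≠ 0 ∧
      f ∈ symDegreeLE K U (chi J ((Y : Set ι)ᶜ) + n) ∧ q = f * pProd K x Y}

/-- The space `P(X, k, J)`, for `k ≥ 0`. -/
def pSpace [Finite ι] {x : ι → U} (J : Set (Flats K x)) (k : ℕ) :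
    Submodule K (SymmetricAlgebra K U) :=
  Submodule.span K (spanningSet J k)

end

end Zonotopal

/-! The Hilbert series and the sum over bases satisfy the same deletion-contraction recursion. For
the recursion to close, the statement is generalized: `χ + k` is replaced by any degree bound `d`
that is monotone under inclusion of spans and takes at most two consecutive values, and the vectors
indexed by `S` need not span `U`. Write `P(S, d)` for `prodSpace`, spanned by the `f p_Y` with `deg
f < d (S \ Y)`; the strict inequality makes the value `0` stand for the zero space.

For `x_m ≠ 0` there is an exact sequence `0 → P(S \ m, d) → P(S, d) → P(S / m, d') → 0`, in which
the first map is multiplication by `x_m` and the second is induced by `U → U / x_m`. Everything is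
formal except exactness in the middle: if `x_m h` lies in `P(S, d)`, then `h` must lie in `P(S \ m,
d)`. Generators do not show this. It is visible in a dual description, `kerSpace`, which bounds the
degree of a polynomial along each nonzero direction `η` by the number of vectors off the hyperplane
`η = 0` and the value of `d` on those inside it. These conditions survive division by `x_m`
(`mem_kerSpace_erase_of_ι_mul_mem`), by a perturbation of `η` that uses only that `K` is infinite.
The two descriptions agree outside a degenerate case (`kerSpace_le_prodSpace`).

On the combinatorial side (`activitySeries_of_ne_zero`) `m` is the smallest element of `S`, so that
it is internally active exactly when it is a coloop. Deleting a coloop lowers the rank while `U`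
stays fixed; this is why `basisSeries` counts monomials in `|I| + (dim U - |B|)` variables. -/

namespace Zonotopal

noncomputable section

open Polynomial Module

/-! ### The grading of the symmetric algebra and maps induced by linear maps. -/

section SymmetricAlgebra

variable {K : Type*} [Field K] {U : Type*} [AddCommGroup U] [Module K U]
variable {V : Type*} [AddCommGroup V] [Module K V]

/-- The algebra map `Sym(U) → Sym(U)[T]` sending a vector `u` to `u T`. -/
def dilate (K : Type*) [Field K] (U : Type*) [AddCommGroup U] [Module K U] :
    SymmetricAlgebra K U →ₐ[K] (SymmetricAlgebra K U)[X] :=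
  SymmetricAlgebra.lift
    (((monomial 1 : SymmetricAlgebra K U →ₗ[SymmetricAlgebra K U] _).restrictScalars K) ∘ₗ
      SymmetricAlgebra.ι K U)

@[simp]
theorem dilate_ι (u : U) :
    dilate K U (SymmetricAlgebra.ι K U u) = monomial 1 (SymmetricAlgebra.ι K U u) := by
  simp [dilate]

/-- The homogeneous component of degree `i` of an element of the symmetric algebra. -/
def symComp (K : Type*) [Field K] (U : Type*) [AddCommGroup U] [Module K U] (i : ℕ) :
    SymmetricAlgebra K U →ₗ[K] SymmetricAlgebra K U :=
  ((lcoeff (SymmetricAlgebra K U) i).restrictScalars K) ∘ₗ (dilate K U).toLinearMap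

theorem symComp_apply (i : ℕ) (f : SymmetricAlgebra K U) :
    symComp K U i f = (dilate K U f).coeff i := rfl

theorem dilate_of_mem_symDegree {i : ℕ} {f : SymmetricAlgebra K U} (hf : f ∈ symDegree K U i) :
    dilate K U f = monomial i f := by
  induction hf using Submodule.pow_induction_on_left' with
  | algebraMap r => rw [AlgHom.commutes, Polynomial.algebraMap_apply, monomial_zero_left]
  | add x y i hx hy ihx ihy => rw [map_add, ihx, ihy, map_add]
  | mem_mul m hm i x hx ih =>
    obtain ⟨u, rfl⟩ := hm
    rw [map_mul, ih, dilate_ι, monomial_mul_monomial, add_comm]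

theorem ι_mem_symDegree (u : U) : SymmetricAlgebra.ι K U u ∈ symDegree K U 1 := by
  rw [symDegree, pow_one]
  exact ⟨u, rfl⟩

theorem algebraMap_mem_symDegree (r : K) :
    algebraMap K (SymmetricAlgebra K U) r ∈ symDegree K U 0 := by
  rw [symDegree, pow_zero]
  exact Submodule.algebraMap_mem r

theorem mul_mem_symDegree {i j : ℕ} {f g : SymmetricAlgebra K U} (hf : f ∈ symDegree K U i)
    (hg : g ∈ symDegree K U j) : f * g ∈ symDegree K U (i + j) := by
  rw [symDegree, pow_add]
  exact Submodule.mul_mem_mul hf hg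

theorem symComp_of_mem {i : ℕ} {f : SymmetricAlgebra K U} (hf : f ∈ symDegree K U i) :
    symComp K U i f = f := by
  rw [symComp_apply, dilate_of_mem_symDegree hf, coeff_monomial_same]

theorem symComp_of_mem_ne {i j : ℕ} {f : SymmetricAlgebra K U} (hf : f ∈ symDegree K U i)
    (hij : i ≠ j) : symComp K U j f = 0 := by
  rw [symComp_apply, dilate_of_mem_symDegree hf, coeff_monomial_of_ne _ hij.symm]

theorem symComp_mem (i : ℕ) (f : SymmetricAlgebra K U) : symComp K U i f ∈ symDegree K U i := by
  induction f using SymmetricAlgebra.induction generalizing i with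
  | algebraMap r =>
    rcases eq_or_ne 0 i with rfl | h
    · rw [symComp_of_mem (algebraMap_mem_symDegree r)]
      exact algebraMap_mem_symDegree r
    · rw [symComp_of_mem_ne (algebraMap_mem_symDegree r) h]
      exact zero_mem _
  | ι u =>
    rcases eq_or_ne 1 i with rfl | h
    · rw [symComp_of_mem (ι_mem_symDegree u)]
      exact ι_mem_symDegree u
    · rw [symComp_of_mem_ne (ι_mem_symDegree u) h]
      exact zero_mem _
  | mul a b ha hb =>
    rw [symComp_apply, map_mul, coeff_mul]
    refine Submodule.sum_mem _ fun p hp => ?_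
    rw [← Finset.HasAntidiagonal.mem_antidiagonal.1 hp]
    exact mul_mem_symDegree (ha _) (hb _)
  | add a b ha hb =>
    rw [map_add]
    exact add_mem (ha i) (hb i)

theorem mem_symDegree_iff {i : ℕ} {f : SymmetricAlgebra K U} :
    f ∈ symDegree K U i ↔ symComp K U i f = f :=
  ⟨symComp_of_mem, fun h => h ▸ symComp_mem i f⟩

theorem eval_one_dilate (f : SymmetricAlgebra K U) : (dilate K U f).eval 1 = f := by
  have h : ((Polynomial.aeval (1 : SymmetricAlgebra K U)).restrictScalars K).comp (dilate K U)
      = AlgHom.id K _ := by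
    ext u
    simp
  have := congrArg (fun φ => φ f) h
  simpa [Polynomial.coe_aeval_eq_eval] using this

theorem sum_symComp (f : SymmetricAlgebra K U) :
    ∑ i ∈ Finset.range ((dilate K U f).natDegree + 1), symComp K U i f = f := by
  conv_rhs => rw [← eval_one_dilate f, eval_eq_sum_range]
  simp [symComp_apply]

/-- The elements of the symmetric algebra all of whose components have degree less than `d`. -/
def symLT (K : Type*) [Field K] (U : Type*) [AddCommGroup U] [Module K U] (d : ℕ) :
    Submodule K (SymmetricAlgebra K U) :=
  ⨅ i ≥ d, LinearMap.ker (symComp K U i)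

theorem mem_symLT {d : ℕ} {f : SymmetricAlgebra K U} :
    f ∈ symLT K U d ↔ ∀ i ≥ d, symComp K U i f = 0 := by
  simp [symLT]

theorem mem_symLT_of_mem_symDegree {i d : ℕ} (hid : i < d) {f : SymmetricAlgebra K U}
    (hf : f ∈ symDegree K U i) : f ∈ symLT K U d :=
  mem_symLT.2 fun _ hj => symComp_of_mem_ne hf (by omega)

theorem symComp_mem_symLT {d : ℕ} {f : SymmetricAlgebra K U} (hf : f ∈ symLT K U d) (i : ℕ) :
    symComp K U i f ∈ symLT K U d := by
  rcases lt_or_ge i d with h | h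
  · exact mem_symLT_of_mem_symDegree h (symComp_mem i f)
  · rw [mem_symLT.1 hf i h]
    exact zero_mem _

theorem symLT_zero : symLT K U 0 = ⊥ := by
  refine (Submodule.eq_bot_iff _).2 fun f hf => ?_
  rw [← sum_symComp f]
  exact Finset.sum_eq_zero fun i _ => mem_symLT.1 hf i (Nat.zero_le i)

theorem symDegreeLE_eq_symLT (d : ℕ) : symDegreeLE K U d = symLT K U (d + 1) := by
  apply le_antisymm
  · refine iSup₂_le fun i hi f hf => ?_
    exact mem_symLT_of_mem_symDegree (Finset.mem_range.1 hi) hf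
  · intro f hf
    rw [← sum_symComp f]
    refine Submodule.sum_mem _ fun i _ => ?_
    rcases lt_or_ge i (d + 1) with h | h
    · exact Submodule.mem_iSup_of_mem i
        (Submodule.mem_iSup_of_mem (Finset.mem_range.2 h) (symComp_mem i f))
    · rw [mem_symLT.1 hf i h]
      exact zero_mem _

theorem symComp_mul_of_mem {j : ℕ} {g : SymmetricAlgebra K U} (hg : g ∈ symDegree K U j)
    (f : SymmetricAlgebra K U) (i : ℕ) :
    symComp K U (i + j) (f * g) = symComp K U i f * g := by
  rw [symComp_apply, map_mul, dilate_of_mem_symDegree hg, coeff_mul_monomial, symComp_apply]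

theorem symComp_mul_of_mem_lt {i j : ℕ} (hij : i < j) {g : SymmetricAlgebra K U}
    (hg : g ∈ symDegree K U j) (f : SymmetricAlgebra K U) :
    symComp K U i (f * g) = 0 := by
  rw [symComp_apply, map_mul, dilate_of_mem_symDegree hg, ← C_mul_X_pow_eq_monomial,
    ← mul_assoc, coeff_mul_X_pow', if_neg (by omega)]

/-- The algebra map between symmetric algebras induced by a linear map. -/
def symMap (φ : U →ₗ[K] V) : SymmetricAlgebra K U →ₐ[K] SymmetricAlgebra K V :=
  SymmetricAlgebra.lift (SymmetricAlgebra.ι K V ∘ₗ φ)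

@[simp]
theorem symMap_ι (φ : U →ₗ[K] V) (u : U) :
    symMap φ (SymmetricAlgebra.ι K U u) = SymmetricAlgebra.ι K V (φ u) := by
  simp [symMap]

theorem symMap_surjective {φ : U →ₗ[K] V} (hφ : Function.Surjective φ) :
    Function.Surjective (symMap φ) := by
  intro f
  induction f using SymmetricAlgebra.induction with
  | algebraMap r => exact ⟨algebraMap K _ r, AlgHom.commutes _ r⟩
  | ι v =>
    obtain ⟨u, rfl⟩ := hφ v
    exact ⟨_, symMap_ι φ u⟩
  | mul a b ha hb =>
    obtain ⟨a, rfl⟩ := ha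
    obtain ⟨b, rfl⟩ := hb
    exact ⟨a * b, map_mul _ a b⟩
  | add a b ha hb =>
    obtain ⟨a, rfl⟩ := ha
    obtain ⟨b, rfl⟩ := hb
    exact ⟨a + b, map_add _ a b⟩

theorem dilate_symMap (φ : U →ₗ[K] V) (f : SymmetricAlgebra K U) :
    dilate K V (symMap φ f) = (dilate K U f).map (symMap φ : _ →+* SymmetricAlgebra K V) := by
  have h : (dilate K V).comp (symMap φ) = (Polynomial.mapAlgHom (symMap φ)).comp (dilate K U) := by
    ext u : 2
    simp
  exact congrArg (fun ψ => ψ f) h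

theorem symComp_symMap (φ : U →ₗ[K] V) (f : SymmetricAlgebra K U) (i : ℕ) :
    symComp K V i (symMap φ f) = symMap φ (symComp K U i f) := by
  rw [symComp_apply, dilate_symMap, coeff_map, symComp_apply]
  rfl

theorem symMap_mem_symLT (φ : U →ₗ[K] V) {d : ℕ} {f : SymmetricAlgebra K U}
    (hf : f ∈ symLT K U d) : symMap φ f ∈ symLT K V d :=
  mem_symLT.2 fun i hi => by rw [symComp_symMap, mem_symLT.1 hf i hi, map_zero]

theorem symMap_mem_symDegree (φ : U →ₗ[K] V) {d : ℕ} {f : SymmetricAlgebra K U}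
    (hf : f ∈ symDegree K U d) : symMap φ f ∈ symDegree K V d :=
  mem_symDegree_iff.2 (by rw [symComp_symMap, symComp_of_mem hf])

theorem exists_mem_symDegree_symMap_eq {φ : U →ₗ[K] V} (hφ : Function.Surjective φ) {i : ℕ}
    {g : SymmetricAlgebra K V} (hg : g ∈ symDegree K V i) :
    ∃ f ∈ symDegree K U i, symMap φ f = g := by
  obtain ⟨f, rfl⟩ := symMap_surjective hφ g
  exact ⟨symComp K U i f, symComp_mem i f, by rw [← symComp_symMap, symComp_of_mem hg]⟩

/-- An arbitrary preimage may have larger degree, so each homogeneous component is lifted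
separately. -/
theorem exists_mem_symLT_symMap_eq {φ : U →ₗ[K] V} (hφ : Function.Surjective φ) {d : ℕ}
    {g : SymmetricAlgebra K V} (hg : g ∈ symLT K V d) :
    ∃ f ∈ symLT K U d, symMap φ f = g := by
  rw [← sum_symComp g]
  have H : ∀ i, ∃ f ∈ symLT K U d, symMap φ f = symComp K V i g := fun i => by
    rcases lt_or_ge i d with h | h
    · obtain ⟨f, hf, hfg⟩ := exists_mem_symDegree_symMap_eq hφ (symComp_mem i g)
      exact ⟨f, mem_symLT_of_mem_symDegree h hf, hfg⟩
    · exact ⟨0, zero_mem _, by rw [map_zero, mem_symLT.1 hg i h]⟩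
  choose f hf hfg using H
  exact ⟨∑ i ∈ Finset.range ((dilate K V g).natDegree + 1), f i,
    Submodule.sum_mem _ fun i _ => hf i, by
      rw [map_sum]; exact Finset.sum_congr rfl fun i _ => hfg i⟩

/-- The kernel of `Sym(U) → Sym(U / x)` is the ideal generated by `x`. -/
theorem ι_dvd_of_symMap_mkQ_eq_zero (x : U) {f : SymmetricAlgebra K U}
    (hf : symMap (K ∙ x).mkQ f = 0) : SymmetricAlgebra.ι K U x ∣ f := by
  let I : Ideal (SymmetricAlgebra K U) := Ideal.span {SymmetricAlgebra.ι K U x}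
  let ψ : U ⧸ (K ∙ x) →ₗ[K] SymmetricAlgebra K U ⧸ I :=
    (K ∙ x).liftQ ((Ideal.Quotient.mkₐ K I).toLinearMap ∘ₗ SymmetricAlgebra.ι K U) <| by
      rw [Submodule.span_singleton_le_iff_mem, LinearMap.mem_ker]
      exact Ideal.Quotient.eq_zero_iff_mem.2 (Ideal.mem_span_singleton_self _)
  -- The projection of `Sym(U)` modulo the ideal `(x)` factors through `Sym(U / x)`, so whatever
  -- dies there lies in the ideal.
  have h : (SymmetricAlgebra.lift ψ).comp (symMap (K ∙ x).mkQ) = Ideal.Quotient.mkₐ K I := by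
    ext u
    simp [ψ]
  have h2 : Ideal.Quotient.mkₐ K I f = 0 := by
    rw [← h, AlgHom.comp_apply, hf, map_zero]
  exact Ideal.mem_span_singleton.1 (Ideal.Quotient.eq_zero_iff_mem.1 h2)

theorem symMap_mkQ_ι_self (x : U) : symMap (K ∙ x).mkQ (SymmetricAlgebra.ι K U x) = 0 := by
  have h : (K ∙ x).mkQ x = 0 :=
    (Submodule.Quotient.mk_eq_zero _).2 (Submodule.mem_span_singleton_self x)
  rw [symMap_ι, h, map_zero]

theorem ι_ne_zero {x : U} (hx : x ≠ 0) : SymmetricAlgebra.ι K U x ≠ 0 := by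
  intro h
  refine hx ((Module.forall_dual_apply_eq_zero_iff K x).1 fun η => ?_)
  rw [← SymmetricAlgebra.lift_ι_apply η x, h, map_zero]

theorem mem_symDegree_of_ι_mul_mem {x : U} (hx : x ≠ 0) {i : ℕ} {h : SymmetricAlgebra K U}
    (hh : SymmetricAlgebra.ι K U x * h ∈ symDegree K U (i + 1)) : h ∈ symDegree K U i := by
  refine mem_symDegree_iff.2 (mul_left_cancel₀ (ι_ne_zero hx) ?_)
  rw [mul_comm, ← symComp_mul_of_mem (ι_mem_symDegree x), mul_comm, symComp_of_mem hh]

end SymmetricAlgebra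

/-! ### The degree of a polynomial along a direction. -/

section DirectionalDegree

variable {K : Type*} [Field K] {U : Type*} [AddCommGroup U] [Module K U]
variable {V : Type*} [AddCommGroup V] [Module K V]

/-- The algebra map `Sym(U) → Sym(U)[T]` sending a vector `u` to `u + η(u) T`. The degree in `T`
of the image of `f` is the degree of the polynomial function `f` along the direction `η`. -/
def translate (η : Dual K U) : SymmetricAlgebra K U →ₐ[K] (SymmetricAlgebra K U)[X] :=
  SymmetricAlgebra.lift
    ((CAlgHom : SymmetricAlgebra K U →ₐ[K] _).toLinearMap ∘ₗ SymmetricAlgebra.ι K U +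
      η.smulRight X)

@[simp]
theorem translate_ι (η : Dual K U) (u : U) :
    translate η (SymmetricAlgebra.ι K U u) = C (SymmetricAlgebra.ι K U u) + η u • X := by
  simp [translate]

theorem translate_symMap (φ : U →ₗ[K] V) (η : Dual K V) (f : SymmetricAlgebra K U) :
    translate η (symMap φ f) =
      (translate (η ∘ₗ φ) f).map (symMap φ : _ →+* SymmetricAlgebra K V) := by
  have h : (translate η).comp (symMap φ) =
      (Polynomial.mapAlgHom (symMap φ)).comp (translate (η ∘ₗ φ)) := by
    ext u : 2
    simp [Algebra.smul_def]
  exact congrArg (fun ψ => ψ f) h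

theorem degree_translate_ι_of_eq_zero {η : Dual K U} {u : U} (hu : u ≠ 0) (h : η u = 0) :
    (translate η (SymmetricAlgebra.ι K U u)).degree = 0 := by
  rw [translate_ι, h, zero_smul, add_zero, degree_C (ι_ne_zero hu)]

theorem degree_translate_ι_of_ne_zero {η : Dual K U} {u : U} (h : η u ≠ 0) :
    (translate η (SymmetricAlgebra.ι K U u)).degree = 1 := by
  rw [translate_ι, Algebra.smul_def, Polynomial.algebraMap_apply, add_comm]
  exact degree_linear (by simpa using h)

theorem degree_translate_le_of_mem_symDegree (η : Dual K U) {i : ℕ} {f : SymmetricAlgebra K U}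
    (hf : f ∈ symDegree K U i) : (translate η f).degree ≤ i := by
  induction hf using Submodule.pow_induction_on_left' with
  | algebraMap r =>
    rw [AlgHom.commutes, Polynomial.algebraMap_apply]
    exact degree_C_le
  | add x y i hx hy ihx ihy =>
    rw [map_add]
    exact (degree_add_le _ _).trans (max_le ihx ihy)
  | mem_mul m hm i x hx ih =>
    obtain ⟨u, rfl⟩ := hm
    rw [map_mul, Nat.succ_eq_add_one, add_comm, Nat.cast_add, Nat.cast_one]
    refine (degree_mul_le _ _).trans (add_le_add ?_ ih)
    rw [translate_ι, Algebra.smul_def, Polynomial.algebraMap_apply, add_comm]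
    exact degree_linear_le

theorem degree_translate_lt_of_mem_symLT (η : Dual K U) {d : ℕ} {f : SymmetricAlgebra K U}
    (hf : f ∈ symLT K U d) : (translate η f).degree < d := by
  rw [← sum_symComp f, map_sum, ← mem_degreeLT]
  refine Submodule.sum_mem _ fun i _ => ?_
  rcases lt_or_ge i d with h | h
  · exact mem_degreeLT.2 ((degree_translate_le_of_mem_symDegree η (symComp_mem i f)).trans_lt
      (by exact_mod_cast h))
  · rw [mem_symLT.1 hf i h, map_zero]
    exact zero_mem _

/-- Killing the vectors in `u + η(u) T` leaves `η(u) T`. Hence the coefficient of `T ^ i` in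
`translate η f` has as constant term the value at `η` of the degree `i` component of `f`. -/
theorem map_algebraMapInv_translate (η : Dual K U) (f : SymmetricAlgebra K U) :
    (translate η f).map (SymmetricAlgebra.algebraMapInv : SymmetricAlgebra K U →ₐ[K] K).toRingHom =
      (dilate K U f).map (SymmetricAlgebra.lift η).toRingHom := by
  have h : (Polynomial.mapAlgHom SymmetricAlgebra.algebraMapInv).comp (translate η) =
      (Polynomial.mapAlgHom (SymmetricAlgebra.lift η)).comp (dilate K U) := by
    ext u : 2
    simp [SymmetricAlgebra.algebraMapInv_ι, Algebra.smul_def, ← C_mul_X_eq_monomial]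
  exact congrArg (fun ψ => ψ f) h

theorem eq_zero_of_forall_lift_eq_zero [Infinite K] {f : SymmetricAlgebra K U}
    (h : ∀ η : Dual K U, SymmetricAlgebra.lift η f = 0) : f = 0 := by
  let b := Basis.ofVectorSpace K U
  apply (SymmetricAlgebra.equivMvPolynomial b).injective
  rw [map_zero]
  refine MvPolynomial.funext fun a => ?_
  have key : (MvPolynomial.aeval a).comp (SymmetricAlgebra.equivMvPolynomial b).toAlgHom =
      SymmetricAlgebra.lift (b.constr K a) := by
    apply SymmetricAlgebra.algHom_ext
    refine b.ext fun i => ?_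
    simp [SymmetricAlgebra.equivMvPolynomial_ι_apply]
  have := congrArg (fun ψ => ψ f) key
  rw [h] at this
  simpa [MvPolynomial.aeval_eq_eval] using this

/-- Over an infinite field, the degree of a polynomial is its largest degree along a line. -/
theorem mem_symLT_of_forall_degree_translate_lt [Infinite K] {d : ℕ} (hd : 1 ≤ d ∨ Nontrivial U)
    {f : SymmetricAlgebra K U} (hf : ∀ η : Dual K U, η ≠ 0 → (translate η f).degree < d) :
    f ∈ symLT K U d := by
  refine mem_symLT.2 fun i hi => eq_zero_of_forall_lift_eq_zero ?_
  have hne : ∀ η : Dual K U, η ≠ 0 → SymmetricAlgebra.lift η (symComp K U i f) = 0 := by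
    intro η hη
    have h := congrArg (fun p => coeff p i) (map_algebraMapInv_translate η f)
    simp only [coeff_map] at h
    rw [coeff_eq_zero_of_degree_lt ((hf η hη).trans_le (by exact_mod_cast hi)), map_zero] at h
    exact h.symm
  intro η
  rcases ne_or_eq η 0 with hη | rfl
  · exact hne η hη
  rcases Nat.eq_zero_or_pos i with rfl | hi0
  -- The degree `0` component is a constant, and its vanishing has to be read off at some nonzero
  -- `η`; this is what `hd` provides.
  · have : Nontrivial U := hd.resolve_left (by omega)
    obtain ⟨η, hη⟩ := exists_ne (0 : Dual K U)
    have h := hne η hη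
    obtain ⟨r, hr⟩ : ∃ r : K, algebraMap K _ r = symComp K U 0 f := by
      have := symComp_mem 0 f
      rw [symDegree, pow_zero] at this
      exact Submodule.mem_one.1 this
    rw [← hr, AlgHom.commutes] at h ⊢
    exact h
  · have h := congrArg (fun p => coeff p i) (map_algebraMapInv_translate (0 : Dual K U)
      (symComp K U i f))
    simp only [coeff_map, dilate_of_mem_symDegree (symComp_mem i f), coeff_monomial_same] at h
    refine h.symm.trans ?_
    have h0 : translate (0 : Dual K U) = CAlgHom := by
      ext u : 2
      simp
    rw [h0, CAlgHom_apply, coeff_C, if_neg hi0.ne', map_zero]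

/-- The degree along a direction is lower semicontinuous in the direction. -/
theorem degree_translate_lt_of_infinite (η θ : Dual K U) {f : SymmetricAlgebra K U} {d : ℕ}
    (h : {ε : K | (translate (η + ε • θ) f).degree < d}.Infinite) :
    (translate η f).degree < d := by
  -- A universal version of `translate (η + ε • θ)`: the outer variable is `T`, the inner one stands
  -- for `ε`.
  let τ := SymmetricAlgebra.lift (R := K) (M := U) (A := (SymmetricAlgebra K U)[X][X])
    (((CAlgHom : (SymmetricAlgebra K U)[X] →ₐ[K] _).comp
      (CAlgHom : SymmetricAlgebra K U →ₐ[K] _)).toLinearMap ∘ₗ SymmetricAlgebra.ι K U +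
      η.smulRight X + θ.smulRight (C X * X))
  have hτ : ∀ ε : K, (translate (η + ε • θ) f) =
      (τ f).map (evalRingHom (algebraMap K (SymmetricAlgebra K U) ε)) := by
    intro ε
    have key : translate (η + ε • θ) =
        (Polynomial.mapAlgHom ((aeval (algebraMap K (SymmetricAlgebra K U) ε)).restrictScalars K)).comp τ := by
      ext u : 2
      simp [τ, Algebra.smul_def, Polynomial.algebraMap_apply]
      ring
    rw [key]
    rfl
  have h0 := hτ 0
  rw [zero_smul, add_zero] at h0
  rw [h0, degree_lt_iff_coeff_zero]
  intro m hm
  suffices hz : (τ f).coeff m = 0 by rw [coeff_map, hz, map_zero]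
  -- The coefficient of `T ^ m` is a polynomial in `ε`, and it has infinitely many roots.
  refine eq_zero_of_infinite_isRoot _ ((h.image
    (FaithfulSMul.algebraMap_injective K (SymmetricAlgebra K U)).injOn).mono ?_)
  rintro _ ⟨ε, hε, rfl⟩
  have := (degree_lt_iff_coeff_zero _ _).1 hε m hm
  rw [hτ, coeff_map] at this
  exact this

end DirectionalDegree

/-! ### The product space and the kernel space under deletion and contraction. -/

section PowerSpace

variable {K : Type*} [Field K] {U : Type*} [AddCommGroup U] [Module K U]
variable {ι : Type*}

/-- A degree bound on the subsequences of `x`: it is monotone with respect to spans, and takes at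
most two consecutive values. -/
structure IsDegreeBound (K : Type*) [Field K] {U : Type*} [AddCommGroup U] [Module K U]
    {ι : Type*} (x : ι → U) (d : Finset ι → ℕ) : Prop where
  mono : ∀ A B : Finset ι,
    Submodule.span K (x '' A) ≤ Submodule.span K (x '' B) → d A ≤ d B
  le_add_one : ∀ A B : Finset ι, d A ≤ d B + 1

/-- The span of the products `f p_Y` with `Y ⊆ S` and `deg f < d (S \ Y)`. -/
def prodSpace (K : Type*) [Field K] {U : Type*} [AddCommGroup U] [Module K U]
    {ι : Type*} [DecidableEq ι] (x : ι → U) (S : Finset ι) (d : Finset ι → ℕ) :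
    Submodule K (SymmetricAlgebra K U) :=
  Submodule.span K {q | ∃ Y ⊆ S, ∃ f ∈ symLT K U (d (S \ Y)), q = f * pProd K x Y}

open scoped Classical in
/-- The elements of `S` on which a linear form does not vanish. -/
def offHyperplane (x : ι → U) (S : Finset ι) (η : Dual K U) : Finset ι :=
  S.filter fun i => η (x i) ≠ 0

/-- The polynomials whose degree along every nonzero direction `η` is less than the number of
vectors off the hyperplane `η = 0` plus the value of `d` on the vectors in the hyperplane. -/
def kerSpace (K : Type*) [Field K] {U : Type*} [AddCommGroup U] [Module K U]
    {ι : Type*} [DecidableEq ι] (x : ι → U) (S : Finset ι) (d : Finset ι → ℕ) :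
    Submodule K (SymmetricAlgebra K U) :=
  ⨅ η : {η : Dual K U // η ≠ 0},
    ((degreeLT (SymmetricAlgebra K U)
      ((offHyperplane x S η.1).card + d (S \ offHyperplane x S η.1))).restrictScalars K).comap
        (translate η.1).toLinearMap

variable {x : ι → U} {S : Finset ι} {d : Finset ι → ℕ}

theorem mem_offHyperplane {η : Dual K U} {i : ι} :
    i ∈ offHyperplane x S η ↔ i ∈ S ∧ η (x i) ≠ 0 := by
  simp [offHyperplane]

theorem degree_translate_pProd_le (η : Dual K U) (Y : Finset ι) :
    (translate η (pProd K x Y)).degree ≤ (offHyperplane x Y η).card := by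
  rw [pProd, map_prod]
  refine (degree_prod_le _ _).trans ?_
  rw [offHyperplane, Finset.card_filter, Nat.cast_sum]
  refine Finset.sum_le_sum fun i _ => ?_
  split_ifs with h
  · exact (degree_translate_ι_of_ne_zero h).le
  · rw [translate_ι, not_not.1 h, zero_smul, add_zero]
    exact degree_C_le

theorem pProd_mem_symDegree (Y : Finset ι) : pProd K x Y ∈ symDegree K U Y.card := by
  classical
  induction Y using Finset.induction_on with
  | empty => simpa [pProd] using algebraMap_mem_symDegree (U := U) (1 : K)
  | insert a s ha ih =>
    rw [pProd, Finset.prod_insert ha, Finset.card_insert_of_notMem ha, add_comm]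
    exact mul_mem_symDegree (ι_mem_symDegree _) ih

theorem symMap_pProd {V : Type*} [AddCommGroup V] [Module K V] (φ : U →ₗ[K] V) (Y : Finset ι) :
    symMap φ (pProd K x Y) = pProd K (φ ∘ x) Y := by
  simp [pProd]

variable [DecidableEq ι]

theorem mem_kerSpace {f : SymmetricAlgebra K U} :
    f ∈ kerSpace K x S d ↔ ∀ η : Dual K U, η ≠ 0 → (translate η f).degree <
      (((offHyperplane x S η).card + d (S \ offHyperplane x S η) : ℕ) : WithBot ℕ) := by
  simp only [kerSpace, Submodule.mem_iInf, Submodule.mem_comap, Submodule.restrictScalars_mem,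
    mem_degreeLT, Subtype.forall]
  rfl

theorem mul_pProd_mem_prodSpace {Y : Finset ι} (hY : Y ⊆ S) {f : SymmetricAlgebra K U}
    (hf : f ∈ symLT K U (d (S \ Y))) : f * pProd K x Y ∈ prodSpace K x S d :=
  Submodule.subset_span ⟨Y, hY, f, hf, rfl⟩

theorem prodSpace_le_kerSpace (hd : IsDegreeBound K x d) : prodSpace K x S d ≤ kerSpace K x S d := by
  refine Submodule.span_le.2 ?_
  rintro _ ⟨Y, hY, f, hf, rfl⟩
  refine mem_kerSpace.2 fun η _ => ?_
  rw [map_mul]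
  refine (degree_mul_le _ _).trans_lt ?_
  have h1 := degree_translate_lt_of_mem_symLT η hf
  have h2 := degree_translate_pProd_le (x := x) η Y
  have hnat : d (S \ Y) + (offHyperplane x Y η).card ≤
      (offHyperplane x S η).card + d (S \ offHyperplane x S η) := by
    -- If `Y` contains all vectors off the hyperplane, monotonicity of `d` suffices. Otherwise `Y`
    -- misses one of them, and this gain of one pays for the at most one unit that `d (S \ Y)` can
    -- exceed the hyperplane's value.
    by_cases hsub : offHyperplane x S η ⊆ Y
    · have e : offHyperplane x S η = offHyperplane x Y η := by
        ext i
        simp only [mem_offHyperplane]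
        exact ⟨fun h => ⟨hsub (mem_offHyperplane.2 h), h.2⟩, fun h => ⟨hY h.1, h.2⟩⟩
      have := hd.mono (S \ Y) (S \ offHyperplane x S η) (Submodule.span_mono
        (Set.image_mono (by exact_mod_cast Finset.sdiff_subset_sdiff le_rfl hsub)))
      rw [e] at this ⊢
      omega
    · have hlt : (offHyperplane x Y η).card < (offHyperplane x S η).card := by
        refine Finset.card_lt_card (Finset.ssubset_iff_subset_ne.2 ⟨fun i hi => ?_, fun h => hsub ?_⟩)
        · rw [mem_offHyperplane] at hi ⊢
          exact ⟨hY hi.1, hi.2⟩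
        · rw [← h]
          exact fun i hi => (mem_offHyperplane.1 hi).1
      have := hd.le_add_one (S \ Y) (S \ offHyperplane x S η)
      omega
  refine lt_of_lt_of_le ?_ (Nat.cast_le.2 hnat)
  rw [Nat.cast_add]
  exact (add_le_add_right h2 _).trans_lt (WithBot.add_lt_add_right WithBot.coe_ne_bot h1)

theorem symComp_mem_prodSpace {f : SymmetricAlgebra K U} (hf : f ∈ prodSpace K x S d) (i : ℕ) :
    symComp K U i f ∈ prodSpace K x S d := by
  suffices prodSpace K x S d ≤ (prodSpace K x S d).comap (symComp K U i) from this hf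
  refine Submodule.span_le.2 ?_
  rintro _ ⟨Y, hY, f, hf, rfl⟩
  have hp := pProd_mem_symDegree (K := K) (x := x) Y
  rcases lt_or_ge i Y.card with h | h
  · rw [SetLike.mem_coe, Submodule.mem_comap, symComp_mul_of_mem_lt h hp]
    exact zero_mem _
  · obtain ⟨j, rfl⟩ := Nat.exists_eq_add_of_le' h
    rw [SetLike.mem_coe, Submodule.mem_comap, symComp_mul_of_mem hp]
    exact mul_pProd_mem_prodSpace hY (symComp_mem_symLT hf j)

theorem ι_mul_mem_prodSpace {m : ι} (hm : m ∈ S) {h : SymmetricAlgebra K U}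
    (hh : h ∈ prodSpace K x (S.erase m) d) :
    SymmetricAlgebra.ι K U (x m) * h ∈ prodSpace K x S d := by
  suffices prodSpace K x (S.erase m) d ≤
      (prodSpace K x S d).comap (LinearMap.mulLeft K (SymmetricAlgebra.ι K U (x m))) from this hh
  refine Submodule.span_le.2 ?_
  rintro _ ⟨Y, hY, f, hf, rfl⟩
  have hmY : m ∉ Y := fun h => Finset.notMem_erase m S (hY h)
  have e : S \ insert m Y = S.erase m \ Y := by
    ext i; simp only [Finset.mem_sdiff, Finset.mem_insert, Finset.mem_erase]; tauto
  have := mul_pProd_mem_prodSpace (K := K) (x := x) (d := d) (S := S) (Y := insert m Y) (f := f)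
    (Finset.insert_subset hm (hY.trans (Finset.erase_subset _ _))) (by rwa [e])
  rw [pProd, Finset.prod_insert hmY] at this
  rw [SetLike.mem_coe, Submodule.mem_comap, LinearMap.mulLeft_apply, mul_left_comm]
  exact this

/-- Contraction maps the space of `x` onto the space of the contraction. -/
theorem map_symMap_prodSpace {m : ι} (hm : m ∈ S) :
    (prodSpace K x S d).map (symMap (K ∙ x m).mkQ).toLinearMap =
      prodSpace K ((K ∙ x m).mkQ ∘ x) (S.erase m) (fun A => d (insert m A)) := by
  have hS : ∀ Y : Finset ι, m ∉ Y → insert m (S.erase m \ Y) = S \ Y := by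
    intro Y hY
    ext i
    by_cases h : i = m <;> simp [h, hm, hY]
  apply le_antisymm
  · rw [prodSpace, Submodule.map_span_le]
    rintro _ ⟨Y, hY, f, hf, rfl⟩
    by_cases hmY : m ∈ Y
    · have h0 : symMap (K ∙ x m).mkQ (pProd K x Y) = 0 := by
        rw [pProd, map_prod]
        exact Finset.prod_eq_zero hmY (symMap_mkQ_ι_self (x m))
      rw [AlgHom.toLinearMap_apply, map_mul, h0, mul_zero]
      exact zero_mem _
    · rw [AlgHom.toLinearMap_apply, map_mul, symMap_pProd]
      refine mul_pProd_mem_prodSpace (Finset.subset_erase.2 ⟨hY, hmY⟩) ?_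
      rw [hS Y hmY]
      exact symMap_mem_symLT _ hf
  · refine Submodule.span_le.2 ?_
    rintro _ ⟨Y, hY, f, hf, rfl⟩
    have hmY : m ∉ Y := fun h => Finset.notMem_erase m S (hY h)
    replace hf : f ∈ symLT K _ (d (insert m (S.erase m \ Y))) := hf
    rw [hS Y hmY] at hf
    obtain ⟨g, hg, rfl⟩ := exists_mem_symLT_symMap_eq (Submodule.mkQ_surjective _) hf
    refine ⟨g * pProd K x Y, mul_pProd_mem_prodSpace (hY.trans (Finset.erase_subset _ _)) hg, ?_⟩
    rw [AlgHom.toLinearMap_apply, map_mul, symMap_pProd]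

/-- Contraction maps the kernel space of `x` into the kernel space of the contraction. -/
theorem symMap_mem_kerSpace {m : ι} (hm : m ∈ S) {f : SymmetricAlgebra K U}
    (hf : f ∈ kerSpace K x S d) :
    symMap (K ∙ x m).mkQ f ∈
      kerSpace K ((K ∙ x m).mkQ ∘ x) (S.erase m) (fun A => d (insert m A)) := by
  refine mem_kerSpace.2 fun η hη => ?_
  have hη' : η ∘ₗ (K ∙ x m).mkQ ≠ 0 := by
    intro h
    refine hη (LinearMap.ext fun q => ?_)
    obtain ⟨u, rfl⟩ := Submodule.mkQ_surjective _ q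
    exact LinearMap.congr_fun h u
  have hηm : η ((K ∙ x m).mkQ (x m)) = 0 := by
    rw [Submodule.mkQ_apply, (Submodule.Quotient.mk_eq_zero _).2 (Submodule.mem_span_singleton_self _),
      map_zero]
  have e1 : offHyperplane ((K ∙ x m).mkQ ∘ x) (S.erase m) η =
      offHyperplane x S (η ∘ₗ (K ∙ x m).mkQ) := by
    ext i
    simp only [mem_offHyperplane, Finset.mem_erase, Function.comp_apply, LinearMap.comp_apply]
    refine ⟨fun h => ⟨h.1.2, h.2⟩, fun h => ⟨⟨?_, h.1⟩, h.2⟩⟩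
    rintro rfl
    exact h.2 hηm
  have e2 : insert m (S.erase m \ offHyperplane x S (η ∘ₗ (K ∙ x m).mkQ)) =
      S \ offHyperplane x S (η ∘ₗ (K ∙ x m).mkQ) := by
    ext i
    by_cases h : i = m
    · subst h
      simpa [mem_offHyperplane, hm] using hηm
    · simp [h]
  rw [e1, e2, translate_symMap]
  exact (degree_map_le).trans_lt (mem_kerSpace.1 hf _ hη')

/-- When `η (x m) ≠ 0`, the factor `x m` contributes one to the degree along `η` and one to the
number of vectors off the hyperplane, and the two cancel. -/
theorem degree_translate_lt_of_ι_mul_mem {m : ι} (hm : m ∈ S) {h : SymmetricAlgebra K U}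
    (hh : SymmetricAlgebra.ι K U (x m) * h ∈ kerSpace K x S d) {η : Dual K U} (hη : η (x m) ≠ 0) :
    (translate η h).degree < (((offHyperplane x (S.erase m) η).card +
      d (S.erase m \ offHyperplane x (S.erase m) η) : ℕ) : WithBot ℕ) := by
  have hη0 : η ≠ 0 := fun h0 => hη (by rw [h0, LinearMap.zero_apply])
  have hoff : offHyperplane x S η = insert m (offHyperplane x (S.erase m) η) := by
    ext i
    by_cases h : i = m
    · subst h
      simp [mem_offHyperplane, hm, hη]
    · simp [mem_offHyperplane, h]
  have hin : S \ offHyperplane x S η = S.erase m \ offHyperplane x (S.erase m) η := by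
    rw [hoff]
    ext i; simp only [Finset.mem_sdiff, Finset.mem_insert, Finset.mem_erase]; tauto
  have := mem_kerSpace.1 hh η hη0
  rw [hin, hoff, Finset.card_insert_of_notMem (by simp [mem_offHyperplane]), map_mul, degree_mul,
    degree_translate_ι_of_ne_zero hη, add_right_comm, Nat.cast_add, Nat.cast_one,
    add_comm] at this
  by_contra! hle
  exact absurd this (not_lt.2 (add_le_add_left hle 1))

/-- Division by a vector maps the kernel space to the kernel space of the deletion. -/
theorem mem_kerSpace_erase_of_ι_mul_mem [Infinite K] (hd : IsDegreeBound K x d) {m : ι}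
    (hm : m ∈ S) (hxm : x m ≠ 0) {h : SymmetricAlgebra K U}
    (hh : SymmetricAlgebra.ι K U (x m) * h ∈ kerSpace K x S d) :
    h ∈ kerSpace K x (S.erase m) d := by
  refine mem_kerSpace.2 fun η hη => ?_
  by_cases hηm : η (x m) = 0
  swap
  · exact degree_translate_lt_of_ι_mul_mem hm hh hηm
  set O := offHyperplane x (S.erase m) η with hO
  have hoff : offHyperplane x S η = O := by
    ext i
    by_cases h : i = m
    · subst h
      simp [hO, mem_offHyperplane, hηm]
    · simp [hO, mem_offHyperplane, h]
  have hin : S \ O = insert m (S.erase m \ O) := by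
    ext i
    by_cases h : i = m
    · subst h
      simp [hO, mem_offHyperplane, hm]
    · simp [h]
  -- Here `x m` lies in the hyperplane. Removing it can only matter if it shrinks the span of the
  -- vectors there.
  by_cases hspan : x m ∈ Submodule.span K (x '' (S.erase m \ O : Finset ι))
  · have hle : d (S \ O) ≤ d (S.erase m \ O) := by
      rw [hin]
      refine hd.mono _ _ (Submodule.span_le.2 ?_)
      rintro _ ⟨i, hi, rfl⟩
      rcases Finset.mem_insert.1 (Finset.mem_coe.1 hi) with rfl | hi
      · exact hspan
      · exact Submodule.subset_span ⟨i, hi, rfl⟩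
    have := mem_kerSpace.1 hh η hη
    rw [hoff, map_mul, degree_mul, degree_translate_ι_of_eq_zero hxm hηm, zero_add] at this
    exact this.trans_le (Nat.cast_le.2 (by omega))
  -- Tilt the hyperplane by `θ` so that `x m` leaves it while the other vectors inside it stay. The
  -- case `η (x m) ≠ 0` applies to `η + ε • θ`, and semicontinuity carries the bound back to `η`.
  · obtain ⟨θ, hθm, hθ⟩ := Submodule.exists_le_ker_of_notMem hspan
    apply degree_translate_lt_of_infinite η θ
    -- Besides `0`, the values of `ε` for which some vector of `O` would fall into the tilted
    -- hyperplane.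
    let bad : Finset K := by
      classical exact insert 0 (O.image fun i => -(η (x i)) / θ (x i))
    refine (Set.Finite.infinite_compl bad.finite_toSet).mono fun ε hε => ?_
    have hε0 : ε ≠ 0 := fun h0 => hε (by simp [bad, h0])
    have hεm : (η + ε • θ) (x m) ≠ 0 := by simp [hηm, hε0, hθm]
    have hO' : offHyperplane x (S.erase m) (η + ε • θ) = O := by
      ext i
      by_cases hiS : i ∈ S.erase m
      swap
      · simp only [hO, mem_offHyperplane, hiS, false_and]
      by_cases hiO : i ∈ O
      · have hηi : η (x i) ≠ 0 := (mem_offHyperplane.1 hiO).2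
        simp only [hiO, iff_true]
        refine mem_offHyperplane.2 ⟨hiS, fun h0 => ?_⟩
        rw [LinearMap.add_apply, LinearMap.smul_apply, smul_eq_mul] at h0
        have hθi : θ (x i) ≠ 0 := fun h1 => hηi (by rw [h1, mul_zero, add_zero] at h0; exact h0)
        refine hε ?_
        have : ε = -(η (x i)) / θ (x i) := by
          rw [eq_div_iff hθi]
          linear_combination h0
        rw [this]
        simp only [bad, Finset.coe_insert, Finset.coe_image]
        exact Or.inr ⟨i, hiO, rfl⟩
      · simp only [hiO, iff_false]
        intro h0
        have hηi : η (x i) = 0 := by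
          by_contra h1
          exact hiO (mem_offHyperplane.2 ⟨hiS, h1⟩)
        have hθi : θ (x i) = 0 :=
          hθ (Submodule.subset_span ⟨i, by simpa [hiO, and_comm] using hiS, rfl⟩)
        exact (mem_offHyperplane.1 h0).2 (by simp [hηi, hθi])
    have := degree_translate_lt_of_ι_mul_mem hm hh hεm
    rwa [hO'] at this

theorem comap_mkQ_span_image (m : ι) (A : Finset ι) :
    (Submodule.span K (((K ∙ x m).mkQ ∘ x) '' A)).comap (K ∙ x m).mkQ =
      Submodule.span K (x '' (insert m A : Finset ι)) := by
  rw [Set.image_comp, ← Submodule.map_span, Submodule.comap_map_mkQ, Finset.coe_insert,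
    Set.image_insert_eq, Submodule.span_insert]

theorem IsDegreeBound.contract (hd : IsDegreeBound K x d) (m : ι) :
    IsDegreeBound K ((K ∙ x m).mkQ ∘ x) (fun A => d (insert m A)) where
  mono A B h := by
    refine hd.mono _ _ ?_
    rw [← comap_mkQ_span_image, ← comap_mkQ_span_image]
    exact Submodule.comap_mono h
  le_add_one A B := hd.le_add_one _ _

/-- A zero vector kills every product containing it and does not change any span, hence no value of
`d`. -/
theorem prodSpace_erase_of_eq_zero (hd : IsDegreeBound K x d) {m : ι} (hm : m ∈ S)
    (hxm : x m = 0) : prodSpace K x (S.erase m) d = prodSpace K x S d := by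
  have hdd : ∀ Y : Finset ι, m ∉ Y → d (S.erase m \ Y) = d (S \ Y) := by
    intro Y hY
    have e : S \ Y = insert m (S.erase m \ Y) := by
      ext i
      by_cases h : i = m <;> simp [h, hm, hY]
    have : Submodule.span K (x '' (S \ Y : Finset ι)) =
        Submodule.span K (x '' (S.erase m \ Y : Finset ι)) := by
      rw [e, Finset.coe_insert, Set.image_insert_eq, hxm, Submodule.span_insert_zero]
    exact le_antisymm (hd.mono _ _ this.ge) (hd.mono _ _ this.le)
  apply le_antisymm <;> refine Submodule.span_le.2 ?_
  · rintro _ ⟨Y, hY, f, hf, rfl⟩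
    rw [hdd Y fun h => Finset.notMem_erase m S (hY h)] at hf
    exact mul_pProd_mem_prodSpace (hY.trans (Finset.erase_subset _ _)) hf
  · rintro _ ⟨Y, hY, f, hf, rfl⟩
    by_cases hmY : m ∈ Y
    · rw [pProd, Finset.prod_eq_zero hmY (by rw [hxm, map_zero]), mul_zero]
      exact zero_mem _
    · rw [← hdd Y hmY] at hf
      exact mul_pProd_mem_prodSpace (Finset.subset_erase.2 ⟨hY, hmY⟩) hf

theorem kerSpace_le_kerSpace_erase_of_eq_zero (hd : IsDegreeBound K x d) {m : ι}
    (hxm : x m = 0) : kerSpace K x S d ≤ kerSpace K x (S.erase m) d := by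
  intro f hf
  refine mem_kerSpace.2 fun η hη => (mem_kerSpace.1 hf η hη).trans_le (Nat.cast_le.2 ?_)
  have hoff : offHyperplane x (S.erase m) η = offHyperplane x S η := by
    ext i
    simp only [mem_offHyperplane, Finset.mem_erase]
    refine ⟨fun h => ⟨h.1.2, h.2⟩, fun h => ⟨⟨?_, h.1⟩, h.2⟩⟩
    rintro rfl
    exact h.2 (by rw [hxm, map_zero])
  rw [hoff]
  refine Nat.add_le_add_left (hd.mono _ _ (Submodule.span_le.2 ?_)) _
  rintro _ ⟨i, hi, rfl⟩
  by_cases h : i = m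
  · rw [h, hxm]
    exact zero_mem _
  · exact Submodule.subset_span ⟨i, by simpa [h] using hi, rfl⟩

end PowerSpace

/-! ### Equality of the kernel and product descriptions. -/

section KernelTheorem

universe v

/-- By induction, the image of `f` in the contraction is in the product space and lifts to some `g`
in `P(S, d)`; then `f - g = x_m h` with `h` in the kernel space of the deletion. The condition `hS`
excludes `d S = 0` with `S` spanning: there the product space is zero, but the kernel space need not
be, for instance when `U = 0`. -/
theorem kerSpace_le_prodSpace {K : Type*} [Field K] [Infinite K] {ι : Type*} [DecidableEq ι]
    {U : Type v} [AddCommGroup U] [Module K U] {x : ι → U} {S : Finset ι} {d : Finset ι → ℕ}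
    (hd : IsDegreeBound K x d) (hS : 1 ≤ d S ∨ Submodule.span K (x '' S) ≠ ⊤) :
    kerSpace K x S d ≤ prodSpace K x S d := by
  induction hn : S.card generalizing U S d with
  | zero =>
    obtain rfl := Finset.card_eq_zero.1 hn
    intro f hf
    have hf' : f ∈ symLT K U (d ∅) := by
      apply mem_symLT_of_forall_degree_translate_lt
      · refine hS.imp_right fun h => ?_
        by_contra hU
        rw [not_nontrivial_iff_subsingleton] at hU
        exact h (Subsingleton.elim _ _)
      · intro η hη
        have := mem_kerSpace.1 hf η hη
        have e : offHyperplane x ∅ η = ∅ := by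
          ext i
          simp [mem_offHyperplane]
        simpa [e] using this
    have := mul_pProd_mem_prodSpace (K := K) (x := x) (S := ∅) (d := d) (Y := ∅) le_rfl
      (f := f) (by simpa using hf')
    simpa [pProd] using this
  | succ n ih =>
    obtain ⟨m, hm⟩ : S.Nonempty := Finset.card_pos.1 (by omega)
    have hcard : (S.erase m).card = n := by rw [Finset.card_erase_of_mem hm, hn]; rfl
    have hdel : 1 ≤ d (S.erase m) ∨ Submodule.span K (x '' (S.erase m : Finset ι)) ≠ ⊤ := by
      -- If the deletion still spans `U`, monotonicity gives `d S ≤ d (S.erase m)`, so the condition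
      -- is inherited.
      by_contra! hcon
      have htop : Submodule.span K (x '' (S : Finset ι)) = ⊤ :=
        top_le_iff.1 (hcon.2 ▸ Submodule.span_mono
          (Set.image_mono (by exact_mod_cast Finset.erase_subset m S)))
      have h1 := hS.resolve_right (not_not.2 htop)
      have h2 := hd.mono S (S.erase m) (by rw [hcon.2]; exact le_top)
      omega
    by_cases hxm : x m = 0
    · rw [← prodSpace_erase_of_eq_zero hd hm hxm]
      exact (kerSpace_le_kerSpace_erase_of_eq_zero hd hxm).trans (ih hd hdel hcard)
    · intro f hf
      have h1 : symMap (K ∙ x m).mkQ f ∈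
          prodSpace K ((K ∙ x m).mkQ ∘ x) (S.erase m) (fun A => d (insert m A)) := by
        refine ih (hd.contract m) ?_ hcard (symMap_mem_kerSpace hm hf)
        rw [Finset.insert_erase hm]
        refine hS.imp_right fun h h' => h ?_
        rw [← Finset.insert_erase hm, ← comap_mkQ_span_image, h', Submodule.comap_top]
      rw [← map_symMap_prodSpace hm] at h1
      obtain ⟨g, hg, hgf⟩ := h1
      have h2 : symMap (K ∙ x m).mkQ (f - g) = 0 := by
        rw [map_sub, ← hgf]
        exact sub_self _
      obtain ⟨h, hh⟩ := ι_dvd_of_symMap_mkQ_eq_zero (x m) h2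
      have h3 : f - g ∈ kerSpace K x S d := sub_mem hf (prodSpace_le_kerSpace hd hg)
      rw [hh] at h3
      have h4 := ι_mul_mem_prodSpace hm
        (ih hd hdel hcard (mem_kerSpace_erase_of_ι_mul_mem hd hm hxm h3))
      rw [← hh] at h4
      simpa using add_mem h4 hg

end KernelTheorem

/-! ### Deletion-contraction for Hilbert series. -/

section Hilbert

universe v

theorem finrank_quotient_span_singleton_add_one {K : Type*} [Field K] {U : Type v} [AddCommGroup U]
    [Module K U] [FiniteDimensional K U] {x : U} (hx : x ≠ 0) :
    finrank K (U ⧸ (K ∙ x)) + 1 = finrank K U := by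
  rw [← Submodule.finrank_quotient_add_finrank (K ∙ x), finrank_span_singleton hx]

variable {K : Type*} [Field K] {U : Type v} [AddCommGroup U] [Module K U]

instance finite_symDegree [FiniteDimensional K U] (i : ℕ) :
    FiniteDimensional K (symDegree K U i) := by
  have : (LinearMap.range (SymmetricAlgebra.ι K U)).FG := Module.Finite.iff_fg.1 inferInstance
  exact Module.Finite.iff_fg.2 (this.pow i)

instance finite_gradedPart [FiniteDimensional K U] (P : Submodule K (SymmetricAlgebra K U))
    (i : ℕ) : FiniteDimensional K (gradedPart P i) :=
  Submodule.finiteDimensional_inf_right _ _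

/-- Rank-nullity for `P → Q`: the kernel consists of the multiples of `x` in `P`, and it equals `x
P'`. -/
theorem finrank_eq_add_of_map_symMap {x : U} (hx : x ≠ 0)
    {P P' : Submodule K (SymmetricAlgebra K U)} [FiniteDimensional K P]
    {Q : Submodule K (SymmetricAlgebra K (U ⧸ (K ∙ x)))}
    (hQ : P.map (symMap (K ∙ x).mkQ).toLinearMap = Q)
    (hmul : ∀ h ∈ P', SymmetricAlgebra.ι K U x * h ∈ P)
    (hdiv : ∀ h, SymmetricAlgebra.ι K U x * h ∈ P → h ∈ P') :
    finrank K P = finrank K P' + finrank K Q := by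
  set φ := (symMap (K ∙ x).mkQ).toLinearMap with hφ
  have hinj : Function.Injective (LinearMap.mulLeft K (SymmetricAlgebra.ι K U x)) :=
    fun a b h => mul_left_cancel₀ (ι_ne_zero hx) h
  have hker : (LinearMap.ker (φ.domRestrict P)).map P.subtype =
      P'.map (LinearMap.mulLeft K (SymmetricAlgebra.ι K U x)) := by
    ext f
    simp only [Submodule.mem_map, LinearMap.mem_ker, LinearMap.domRestrict_apply,
      Submodule.subtype_apply, Subtype.exists, exists_and_right, exists_eq_right,
      LinearMap.mulLeft_apply]
    constructor
    · rintro ⟨hf, h0⟩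
      obtain ⟨h, rfl⟩ := ι_dvd_of_symMap_mkQ_eq_zero x h0
      exact ⟨h, hdiv h hf, rfl⟩
    · rintro ⟨h, hh, rfl⟩
      refine ⟨hmul h hh, ?_⟩
      rw [hφ, AlgHom.toLinearMap_apply, map_mul, symMap_mkQ_ι_self, zero_mul]
  have h1 := LinearMap.finrank_range_add_finrank_ker (φ.domRestrict P)
  rw [LinearMap.range_domRestrict, hQ, ← Submodule.finrank_map_subtype_eq, hker,
    ← (Submodule.equivMapOfInjective _ hinj P').finrank_eq] at h1
  rw [← h1, add_comm]

theorem map_symMap_symDegree {V : Type*} [AddCommGroup V] [Module K V] {φ : U →ₗ[K] V}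
    (hφ : Function.Surjective φ) (i : ℕ) :
    (symDegree K U i).map (symMap φ).toLinearMap = symDegree K V i := by
  apply le_antisymm
  · rintro _ ⟨f, hf, rfl⟩
    exact symMap_mem_symDegree φ hf
  · intro g hg
    exact exists_mem_symDegree_symMap_eq hφ hg

/-- The Pascal-type recursion for `Nat.multichoose` matches the sequence `Sym^i(U) → Sym^(i+1)(U) →
Sym^(i+1)(U / x)`. -/
theorem finrank_symDegree (K : Type*) [Field K] (U : Type v) [AddCommGroup U] [Module K U]
    [FiniteDimensional K U] (i : ℕ) :
    finrank K (symDegree K U i) = Nat.multichoose (finrank K U) i := by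
  induction hn : finrank K U generalizing U i with
  | zero =>
    have : Subsingleton U := finrank_zero_iff.1 hn
    cases i with
    | zero =>
      rw [symDegree, pow_zero, Nat.multichoose_zero_right, Submodule.one_eq_span]
      exact finrank_span_singleton one_ne_zero
    | succ i =>
      have : LinearMap.range (SymmetricAlgebra.ι K U) = ⊥ := by
        rw [LinearMap.range_eq_bot]
        ext u
        rw [Subsingleton.elim u 0, map_zero, map_zero]
      rw [symDegree, pow_succ, this, Submodule.mul_bot, finrank_bot, Nat.multichoose_zero_succ]
  | succ n ih =>
    have : Nontrivial U := finrank_pos_iff.1 (by omega : 0 < finrank K U)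
    obtain ⟨x, hx⟩ := exists_ne (0 : U)
    have hq := finrank_quotient_span_singleton_add_one (K := K) hx
    induction i with
    | zero =>
      rw [symDegree, pow_zero, Nat.multichoose_zero_right, Submodule.one_eq_span]
      exact finrank_span_singleton one_ne_zero
    | succ i ihi =>
      rw [finrank_eq_add_of_map_symMap hx
        (map_symMap_symDegree (Submodule.mkQ_surjective (K ∙ x)) (i + 1))
        (P' := symDegree K U i) (fun h hh => ?_) (fun h hh => mem_symDegree_of_ι_mul_mem hx hh),
        ihi, ih _ _ (by omega), Nat.multichoose_succ_succ, add_comm]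
      rw [add_comm i 1]
      exact mul_mem_symDegree (ι_mem_symDegree x) hh

theorem gradedPart_symLT_of_lt {i d : ℕ} (h : i < d) :
    gradedPart (symLT K U d) i = symDegree K U i :=
  inf_eq_right.2 fun _ hf => mem_symLT_of_mem_symDegree h hf

theorem gradedPart_symLT_of_le {i d : ℕ} (h : d ≤ i) : gradedPart (symLT K U d) i = ⊥ := by
  refine (Submodule.eq_bot_iff _).2 fun f hf => ?_
  rw [← symComp_of_mem hf.2]
  exact mem_symLT.1 hf.1 i h

theorem hilb_symLT [FiniteDimensional K U] (d : ℕ) :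
    hilb (symLT K U d) =
      ∑ j ∈ Finset.range d, (Nat.multichoose (finrank K U) j : PowerSeries ℕ) * PowerSeries.X ^ j := by
  ext i
  simp only [hilb, PowerSeries.coeff_mk, map_sum]
  have h : ∀ j, PowerSeries.coeff i
      ((Nat.multichoose (finrank K U) j : PowerSeries ℕ) * PowerSeries.X ^ j) =
      if i = j then Nat.multichoose (finrank K U) j else 0 := by
    intro j
    rw [← map_natCast (PowerSeries.C (R := ℕ)), PowerSeries.coeff_C_mul, PowerSeries.coeff_X_pow]
    simp
  simp only [h, Finset.sum_ite_eq, Finset.mem_range]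
  split_ifs with hi
  · rw [gradedPart_symLT_of_lt hi, finrank_symDegree]
  · rw [gradedPart_symLT_of_le (not_lt.1 hi), finrank_bot]

variable {ι : Type*} [DecidableEq ι] {x : ι → U} {S : Finset ι} {d : Finset ι → ℕ}

theorem prodSpace_empty : prodSpace K x ∅ d = symLT K U (d ∅) := by
  apply le_antisymm
  · refine Submodule.span_le.2 ?_
    rintro _ ⟨Y, hY, f, hf, rfl⟩
    obtain rfl := Finset.subset_empty.1 hY
    simpa [pProd] using hf
  · intro f hf
    simpa [pProd] using mul_pProd_mem_prodSpace (K := K) (x := x) (S := ∅) (d := d) (Y := ∅) le_rfl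
      (f := f) (by simpa using hf)

/-- Exactness in the middle, obtained through the kernel description. In the degenerate case that
`kerSpace_le_prodSpace` excludes, `d` vanishes on all subsets of `S`, so the product space is zero.
-/
theorem mem_prodSpace_erase_of_ι_mul_mem [Infinite K] (hd : IsDegreeBound K x d) {m : ι}
    (hm : m ∈ S) (hxm : x m ≠ 0) {h : SymmetricAlgebra K U}
    (hh : SymmetricAlgebra.ι K U (x m) * h ∈ prodSpace K x S d) :
    h ∈ prodSpace K x (S.erase m) d := by
  by_cases hdel : 1 ≤ d (S.erase m) ∨ Submodule.span K (x '' (S.erase m : Finset ι)) ≠ ⊤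
  · exact kerSpace_le_prodSpace hd hdel
      (mem_kerSpace_erase_of_ι_mul_mem hd hm hxm (prodSpace_le_kerSpace hd hh))
  · push Not at hdel
    have hbot : prodSpace K x S d = ⊥ := by
      refine (Submodule.eq_bot_iff _).2 fun q hq => ?_
      refine (Submodule.mem_bot K).1 (Submodule.span_le.2 ?_ hq)
      rintro _ ⟨Y, hY, f, hf, rfl⟩
      have := hd.mono (S \ Y) (S.erase m) (by rw [hdel.2]; exact le_top)
      rw [show d (S \ Y) = 0 by omega, symLT_zero, Submodule.mem_bot] at hf
      simp [hf]
    rw [hbot, Submodule.mem_bot] at hh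
    rw [(mul_eq_zero.1 hh).resolve_left (ι_ne_zero hxm)]
    exact zero_mem _

/-- Deletion-contraction for the Hilbert series. -/
theorem hilb_prodSpace [Infinite K] [FiniteDimensional K U] (hd : IsDegreeBound K x d) {m : ι}
    (hm : m ∈ S) (hxm : x m ≠ 0) :
    hilb (prodSpace K x S d) = PowerSeries.X * hilb (prodSpace K x (S.erase m) d) +
      hilb (prodSpace K ((K ∙ x m).mkQ ∘ x) (S.erase m) (fun A => d (insert m A))) := by
  have hQ : ∀ i, (gradedPart (prodSpace K x S d) i).map (symMap (K ∙ x m).mkQ).toLinearMap =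
      gradedPart (prodSpace K ((K ∙ x m).mkQ ∘ x) (S.erase m) (fun A => d (insert m A))) i := by
    intro i
    rw [gradedPart, gradedPart, ← map_symMap_prodSpace hm]
    apply le_antisymm
    · rintro _ ⟨f, hf, rfl⟩
      exact ⟨⟨f, hf.1, rfl⟩, symMap_mem_symDegree _ hf.2⟩
    · rintro _ ⟨⟨f, hf, rfl⟩, hf2⟩
      refine ⟨symComp K U i f, ⟨symComp_mem_prodSpace hf i, symComp_mem i f⟩, ?_⟩
      rw [AlgHom.toLinearMap_apply, ← symComp_symMap]
      exact symComp_of_mem hf2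
  ext i
  rw [map_add]
  cases i with
  | zero =>
    simp only [PowerSeries.coeff_zero_X_mul, hilb, PowerSeries.coeff_mk]
    -- In degree `0` no nonzero element is divisible by `x m`, so the deletion contributes nothing.
    rw [finrank_eq_add_of_map_symMap hxm (hQ 0) (P' := ⊥) (by simp) fun h hh => ?_, finrank_bot]
    have h1 := symComp_of_mem hh.2
    rw [mul_comm, symComp_mul_of_mem_lt one_pos (ι_mem_symDegree _)] at h1
    exact (mul_eq_zero.1 h1.symm).resolve_right (ι_ne_zero hxm)
  | succ i =>
    simp only [PowerSeries.coeff_succ_X_mul, hilb, PowerSeries.coeff_mk]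
    refine finrank_eq_add_of_map_symMap hxm (hQ (i + 1)) (fun h hh => ⟨?_, ?_⟩)
      fun h hh => ⟨mem_prodSpace_erase_of_ι_mul_mem hd hm hxm hh.1,
        mem_symDegree_of_ι_mul_mem hxm hh.2⟩
    · exact ι_mul_mem_prodSpace hm hh.1
    · rw [add_comm i 1]
      exact mul_mem_symDegree (ι_mem_symDegree _) hh.2

theorem isGradedSubspace_of_symComp_mem {P : Submodule K (SymmetricAlgebra K U)}
    (hP : ∀ f ∈ P, ∀ i, symComp K U i f ∈ P) : IsGradedSubspace P := by
  refine DirectSum.isInternal_submodule_of_iSupIndep_of_iSup_eq_top ?_ ?_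
  · refine iSupIndep_def.2 fun i => Submodule.disjoint_def.2 fun f hf hf' => ?_
    have hle : (⨆ (j) (_ : j ≠ i), (gradedPart P j).submoduleOf P) ≤
        LinearMap.ker (symComp K U i ∘ₗ P.subtype) :=
      iSup₂_le fun j hj g hg => symComp_of_mem_ne hg.2 hj
    have h0 : symComp K U i f = 0 := hle hf'
    exact Subtype.ext ((symComp_of_mem hf.2).symm.trans h0)
  · refine eq_top_iff.2 fun f _ => ?_
    have : f = ∑ i ∈ Finset.range ((dilate K U f.1).natDegree + 1),
        (⟨symComp K U i f, hP f f.2 i⟩ : P) := by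
      ext
      rw [AddSubmonoidClass.coe_finsetSum]
      exact (sum_symComp f.1).symm
    rw [this]
    exact Submodule.sum_mem _ fun i _ => Submodule.mem_iSup_of_mem i
      ⟨hP f f.2 i, symComp_mem i f.1⟩

end Hilbert

/-! ### Deletion-contraction for the sum over bases. -/

section ActivitySeries

universe v

variable {K : Type*} [Field K] {U : Type v} [AddCommGroup U] [Module K U]
variable {ι : Type*}

open scoped Classical in
/-- The bases of the subsequence of `x` indexed by `S`. -/
def basesOn (K : Type*) [Field K] {U : Type v} [AddCommGroup U] [Module K U]
    {ι : Type*} (x : ι → U) (S : Finset ι) : Finset (Finset ι) :=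
  S.powerset.filter fun B => LinearIndepOn K x (B : Set ι) ∧
    ∀ i ∈ S, x i ∈ Submodule.span K (x '' B)

open scoped Classical in
/-- The internally active elements of `B` with respect to the subsequence indexed by `S`. -/
def intActive (K : Type*) [Field K] {U : Type v} [AddCommGroup U] [Module K U]
    {ι : Type*} [LinearOrder ι] (x : ι → U) (S B : Finset ι) : Finset ι :=
  B.filter fun b => ∀ i ∈ S, x i ∉ Submodule.span K (x '' (B.erase b : Finset ι)) → i ≤ b

open scoped Classical in
/-- The externally active elements for `B` in the subsequence indexed by `S`. -/
def extActive (K : Type*) [Field K] {U : Type v} [AddCommGroup U] [Module K U]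
    {ι : Type*} [LinearOrder ι] (x : ι → U) (S B : Finset ι) : Finset ι :=
  S.filter fun e => e ∉ B ∧ x e ∈ Submodule.span K (x '' (B.filter (· ≤ e) : Finset ι))

/-- The contribution of a basis `B` to the Hilbert series. -/
def basisSeries (K : Type*) [Field K] {U : Type v} [AddCommGroup U] [Module K U]
    {ι : Type*} [LinearOrder ι] (x : ι → U) (S : Finset ι) (d : Finset ι → ℕ) (B : Finset ι) :
    PowerSeries ℕ :=
  PowerSeries.X ^ (S.card - B.card - (extActive K x S B).card) *
    ∑ I ∈ (intActive K x S B).powerset, PowerSeries.X ^ I.card *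
      ∑ j ∈ Finset.range (d ((B ∪ extActive K x S B) \ I)),
        (Nat.multichoose (I.card + (finrank K U - B.card)) j : PowerSeries ℕ) * PowerSeries.X ^ j

variable {x : ι → U} {S : Finset ι} {d : Finset ι → ℕ} {m : ι}

theorem mem_basesOn {B : Finset ι} : B ∈ basesOn K x S ↔ B ⊆ S ∧ LinearIndepOn K x (B : Set ι) ∧
    ∀ i ∈ S, x i ∈ Submodule.span K (x '' B) := by
  simp [basesOn]

theorem span_image_mono {A B : Finset ι} (h : A ⊆ B) :
    Submodule.span K (x '' A) ≤ Submodule.span K (x '' B) :=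
  Submodule.span_mono (Set.image_mono (by exact_mod_cast h))

theorem card_le_finrank_of_mem_basesOn [FiniteDimensional K U] {B : Finset ι}
    (hB : B ∈ basesOn K x S) : B.card ≤ finrank K U := by
  have h := (mem_basesOn.1 hB).2.1
  have := LinearIndependent.fintype_card_le_finrank (R := K) (b := fun i : (B : Set ι) => x i) h
  simpa using this

variable [LinearOrder ι]

theorem mem_intActive {B : Finset ι} {b : ι} : b ∈ intActive K x S B ↔ b ∈ B ∧
    ∀ i ∈ S, x i ∉ Submodule.span K (x '' (B.erase b : Finset ι)) → i ≤ b := by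
  simp only [intActive, Finset.mem_filter]

theorem mem_extActive {B : Finset ι} {e : ι} : e ∈ extActive K x S B ↔ e ∈ S ∧ e ∉ B ∧
    x e ∈ Submodule.span K (x '' (B.filter (· ≤ e) : Finset ι)) := by
  simp only [extActive, Finset.mem_filter]

theorem mkQ_mem_span_iff (m i : ι) (A : Finset ι) :
    ((K ∙ x m).mkQ ∘ x) i ∈ Submodule.span K (((K ∙ x m).mkQ ∘ x) '' A) ↔
      x i ∈ Submodule.span K (x '' (insert m A : Finset ι)) := by
  rw [← comap_mkQ_span_image]
  rfl

theorem linearIndepOn_mkQ_iff (hxm : x m ≠ 0) {B : Finset ι} (hB : m ∉ B) :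
    LinearIndepOn K ((K ∙ x m).mkQ ∘ x) (B : Set ι) ↔
      LinearIndepOn K x ((insert m B : Finset ι) : Set ι) := by
  have h := LinearIndepOn.quotient_iff_union (R := K) (f := x) (s := {m}) (t := (B : Set ι))
    (LinearIndepOn.singleton hxm) (by simpa using hB)
  rw [Set.image_singleton] at h
  rw [h, Finset.coe_insert, Set.insert_eq]

theorem mem_basesOn_contract_iff (hm : m ∈ S) (hxm : x m ≠ 0) {B : Finset ι} (hB : m ∉ B) :
    B ∈ basesOn K ((K ∙ x m).mkQ ∘ x) (S.erase m) ↔ insert m B ∈ basesOn K x S := by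
  rw [mem_basesOn, mem_basesOn, linearIndepOn_mkQ_iff hxm hB]
  refine and_congr ?_ (and_congr_right fun _ => ?_)
  · rw [Finset.subset_erase, Finset.insert_subset_iff]
    tauto
  · refine ⟨fun h i hi => ?_,
      fun h i hi => (mkQ_mem_span_iff m i B).2 (h i (Finset.mem_of_mem_erase hi))⟩
    by_cases him : i = m
    · subst him
      exact Submodule.subset_span ⟨i, by simp, rfl⟩
    · exact (mkQ_mem_span_iff m i B).1 (h i (Finset.mem_erase.2 ⟨him, hi⟩))

theorem sum_basesOn_contract {M : Type*} [AddCommMonoid M] (hm : m ∈ S) (hxm : x m ≠ 0)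
    (F : Finset ι → M) :
    ∑ B ∈ basesOn K x S with m ∈ B, F B =
      ∑ B ∈ basesOn K ((K ∙ x m).mkQ ∘ x) (S.erase m), F (insert m B) := by
  have hnot : ∀ B ∈ basesOn K ((K ∙ x m).mkQ ∘ x) (S.erase m), m ∉ B := fun B hB h =>
    Finset.notMem_erase m S ((mem_basesOn.1 hB).1 h)
  refine Finset.sum_bij' (fun B _ => B.erase m) (fun B _ => insert m B) ?_ ?_ ?_ ?_ ?_
  · intro B hB
    rw [Finset.mem_filter] at hB
    rw [mem_basesOn_contract_iff hm hxm (Finset.notMem_erase m B), Finset.insert_erase hB.2]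
    exact hB.1
  · intro B hB
    exact Finset.mem_filter.2
      ⟨(mem_basesOn_contract_iff hm hxm (hnot B hB)).1 hB, Finset.mem_insert_self m B⟩
  · intro B hB
    exact Finset.insert_erase (Finset.mem_filter.1 hB).2
  · intro B hB
    exact Finset.erase_insert (hnot B hB)
  · intro B hB
    rw [Finset.insert_erase (Finset.mem_filter.1 hB).2]

/-- Since `m` is minimal, it belongs to `{b ∈ insert m B : b ≤ e}` for every `e ∈ S`, which is what
contracting it adds to the span. -/
theorem extActive_contract (hmin : ∀ i ∈ S, m ≤ i) (B : Finset ι) :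
    extActive K ((K ∙ x m).mkQ ∘ x) (S.erase m) B = extActive K x S (insert m B) := by
  ext e
  rw [mem_extActive, mem_extActive, mkQ_mem_span_iff, Finset.mem_erase, Finset.mem_insert, not_or]
  by_cases he : e ∈ S
  · rw [Finset.filter_insert, if_pos (hmin e he)]
    tauto
  · simp [he]

theorem intActive_contract (hmin : ∀ i ∈ S, m ≤ i) {B : Finset ι} (hB : B ⊆ S.erase m) :
    intActive K ((K ∙ x m).mkQ ∘ x) (S.erase m) B = (intActive K x S (insert m B)).erase m := by
  have hmB : m ∉ B := fun h => Finset.notMem_erase m S (hB h)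
  ext b
  rw [Finset.mem_erase, mem_intActive, mem_intActive, Finset.mem_insert]
  by_cases hb : b = m
  · subst hb
    simp [hmB]
  simp only [hb, false_or, ne_eq, not_false_eq_true, true_and]
  refine and_congr_right fun hbB => ?_
  rw [Finset.erase_insert_of_ne (Ne.symm hb)]
  simp only [mkQ_mem_span_iff]
  refine ⟨fun h i hi hx => ?_, fun h i hi => h i (Finset.mem_of_mem_erase hi)⟩
  by_cases him : i = m
  · rw [him]
    exact hmin b (Finset.mem_of_mem_erase (hB hbB))
  · exact h i (Finset.mem_erase.2 ⟨him, hi⟩) hx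

/-- The minimum of `S` can be the maximum of the complement of a closure only if nothing else lies
in that complement. -/
theorem mem_intActive_insert_iff (hmin : ∀ i ∈ S, m ≤ i) {B : Finset ι} (hmB : m ∉ B) :
    m ∈ intActive K x S (insert m B) ↔
      ∀ i ∈ S.erase m, x i ∈ Submodule.span K (x '' B) := by
  rw [mem_intActive, Finset.erase_insert hmB]
  simp only [Finset.mem_insert_self, true_and]
  refine ⟨fun h i hi => ?_, fun h i hi hx => ?_⟩
  · by_contra hx
    exact (Finset.mem_erase.1 hi).1 (le_antisymm (h i (Finset.mem_of_mem_erase hi) hx)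
      (hmin i (Finset.mem_of_mem_erase hi)))
  · by_contra hle
    exact hx (h i (Finset.mem_erase.2 ⟨fun h => hle h.le, hi⟩))

/-- No element of `B` lies below the minimum `m`, so `m` would be externally active only if `x m =
0`. -/
theorem extActive_erase (hmin : ∀ i ∈ S, m ≤ i) (hxm : x m ≠ 0) {B : Finset ι}
    (hB : B ⊆ S.erase m) : extActive K x (S.erase m) B = extActive K x S B := by
  ext e
  rw [mem_extActive, mem_extActive, Finset.mem_erase]
  refine ⟨fun h => ⟨h.1.2, h.2⟩, fun h => ⟨⟨?_, h.1⟩, h.2⟩⟩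
  rintro rfl
  have hempty : B.filter (· ≤ e) = ∅ := by
    refine Finset.filter_eq_empty_iff.2 fun b hb hbe => ?_
    have := Finset.mem_erase.1 (hB hb)
    exact this.1 (le_antisymm hbe (hmin b this.2))
  have := h.2.2
  rw [hempty] at this
  exact hxm (by simpa using this)

theorem intActive_erase (hmin : ∀ i ∈ S, m ≤ i) {B : Finset ι} (hB : B ⊆ S.erase m) :
    intActive K x (S.erase m) B = intActive K x S B := by
  ext b
  rw [mem_intActive, mem_intActive]
  refine and_congr_right fun hb => ⟨fun h i hi hx => ?_,
    fun h i hi => h i (Finset.mem_of_mem_erase hi)⟩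
  by_cases him : i = m
  · rw [him]
    exact hmin b (Finset.mem_of_mem_erase (hB hb))
  · exact h i (Finset.mem_erase.2 ⟨him, hi⟩) hx

/-- Exchange: if `x m` were needed to reach `x i`, it would lie in the span of `A` and `x i`,
against the coloop condition. -/
theorem mem_span_insert_iff_of_coloop
    (hc : x m ∉ Submodule.span K (x '' (S.erase m : Finset ι))) {A : Finset ι}
    (hA : A ⊆ S.erase m) {i : ι} (hi : i ∈ S.erase m) :
    x i ∈ Submodule.span K (x '' (insert m A : Finset ι)) ↔ x i ∈ Submodule.span K (x '' A) := by
  refine ⟨fun h => ?_, fun h => span_image_mono (Finset.subset_insert m A) h⟩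
  by_contra hni
  rw [Finset.coe_insert, Set.image_insert_eq] at h
  have := mem_span_insert_exchange h hni
  rw [← Set.image_insert_eq, ← Finset.coe_insert] at this
  exact hc (span_image_mono (Finset.insert_subset hi hA) this)

theorem basesOn_contract_of_coloop
    (hc : x m ∉ Submodule.span K (x '' (S.erase m : Finset ι))) :
    basesOn K ((K ∙ x m).mkQ ∘ x) (S.erase m) = basesOn K x (S.erase m) := by
  have hxm : x m ≠ 0 := fun h => hc (h ▸ zero_mem _)
  ext B
  rw [mem_basesOn, mem_basesOn]
  refine and_congr_right fun hB => ?_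
  have hmB : m ∉ B := fun h => Finset.notMem_erase m S (hB h)
  refine and_congr ?_ (forall₂_congr fun i hi => ?_)
  · rw [linearIndepOn_mkQ_iff hxm hmB, Finset.coe_insert, linearIndepOn_insert (by simpa using hmB)]
    exact and_iff_left fun h => hc (span_image_mono hB h)
  · rw [mkQ_mem_span_iff, mem_span_insert_iff_of_coloop hc hB hi]

theorem intActive_contract_of_coloop
    (hc : x m ∉ Submodule.span K (x '' (S.erase m : Finset ι))) {B : Finset ι}
    (hB : B ⊆ S.erase m) :
    intActive K ((K ∙ x m).mkQ ∘ x) (S.erase m) B = intActive K x (S.erase m) B := by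
  ext b
  rw [mem_intActive, mem_intActive]
  refine and_congr_right fun _ => forall₂_congr fun i hi => ?_
  rw [mkQ_mem_span_iff,
    mem_span_insert_iff_of_coloop hc ((Finset.erase_subset b B).trans hB) hi]

theorem extActive_contract_of_coloop
    (hc : x m ∉ Submodule.span K (x '' (S.erase m : Finset ι))) {B : Finset ι}
    (hB : B ⊆ S.erase m) :
    extActive K ((K ∙ x m).mkQ ∘ x) (S.erase m) B = extActive K x (S.erase m) B := by
  ext e
  rw [mem_extActive, mem_extActive]
  refine and_congr_right fun he => and_congr_right fun _ => ?_
  rw [mkQ_mem_span_iff,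
    mem_span_insert_iff_of_coloop hc ((Finset.filter_subset _ B).trans hB) he]

theorem card_add_card_extActive_le {B : Finset ι} (hB : B ⊆ S) :
    B.card + (extActive K x S B).card ≤ S.card := by
  rw [← Finset.card_union_of_disjoint]
  · exact Finset.card_le_card (Finset.union_subset hB fun e he => (mem_extActive.1 he).1)
  · exact Finset.disjoint_right.2 fun e he => (mem_extActive.1 he).2.1

/-- The sum of the contributions of all bases. -/
def activitySeries (K : Type*) [Field K] {U : Type v} [AddCommGroup U] [Module K U]
    {ι : Type*} [LinearOrder ι] (x : ι → U) (S : Finset ι) (d : Finset ι → ℕ) : PowerSeries ℕ :=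
  ∑ B ∈ basesOn K x S, basisSeries K x S d B

/-- The part of the contribution of a basis `insert m B` given by sets of internally active
elements avoiding `m` is the contribution of `B` in the contraction. -/
theorem basisSeries_contract [FiniteDimensional K U] (hm : m ∈ S) (hmin : ∀ i ∈ S, m ≤ i)
    (hxm : x m ≠ 0) {B : Finset ι} (hB : B ⊆ S.erase m) :
    basisSeries K ((K ∙ x m).mkQ ∘ x) (S.erase m) (fun A => d (insert m A)) B =
      PowerSeries.X ^ (S.card - (insert m B).card - (extActive K x S (insert m B)).card) *
        ∑ I ∈ ((intActive K x S (insert m B)).erase m).powerset, PowerSeries.X ^ I.card *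
          ∑ j ∈ Finset.range (d ((insert m B ∪ extActive K x S (insert m B)) \ I)),
            (Nat.multichoose (I.card + (finrank K U - (insert m B).card)) j : PowerSeries ℕ) *
              PowerSeries.X ^ j := by
  have hmB : m ∉ B := fun h => Finset.notMem_erase m S (hB h)
  have hfr := finrank_quotient_span_singleton_add_one (K := K) hxm
  have hcard := Finset.card_erase_add_one hm
  rw [basisSeries, extActive_contract hmin, intActive_contract hmin hB,
    Finset.card_insert_of_notMem hmB]
  congr 1
  · congr 1
    omega
  · refine Finset.sum_congr rfl fun I hI => ?_
    have hmI : m ∉ I := fun h => Finset.notMem_erase m _ (Finset.mem_powerset.1 hI h)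
    have e1 : insert m ((B ∪ extActive K x S (insert m B)) \ I) =
        (insert m B ∪ extActive K x S (insert m B)) \ I := by
      rw [Finset.insert_union, Finset.insert_sdiff_of_notMem _ hmI]
    have e2 : finrank K (U ⧸ (K ∙ x m)) - B.card = finrank K U - (B.card + 1) := by omega
    simp only [e1, e2]

/-- If `m` is not a coloop, bases avoiding `m` give the deletion and bases containing it give the
contraction, `m` being never internally active. If `m` is a coloop, it is in every basis and always
internally active; the sets `I` without `m` give the contraction, those with `m` the deletion. -/
theorem activitySeries_of_ne_zero [FiniteDimensional K U] (hm : m ∈ S) (hmin : ∀ i ∈ S, m ≤ i)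
    (hxm : x m ≠ 0) :
    activitySeries K x S d = PowerSeries.X * activitySeries K x (S.erase m) d +
      activitySeries K ((K ∙ x m).mkQ ∘ x) (S.erase m) (fun A => d (insert m A)) := by
  have hsub : ∀ B ∈ basesOn K ((K ∙ x m).mkQ ∘ x) (S.erase m), B ⊆ S.erase m :=
    fun B hB => (mem_basesOn.1 hB).1
  have hcard := Finset.card_erase_add_one hm
  by_cases hc : x m ∈ Submodule.span K (x '' (S.erase m : Finset ι))
  · rw [activitySeries, ← Finset.sum_filter_add_sum_filter_not _ (fun B => m ∈ B), add_comm,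
      sum_basesOn_contract hm hxm]
    congr 1
    · have hfil : (basesOn K x S).filter (fun B => m ∉ B) = basesOn K x (S.erase m) := by
        ext B
        rw [Finset.mem_filter, mem_basesOn, mem_basesOn, Finset.subset_erase]
        constructor
        · rintro ⟨⟨h1, h2, h3⟩, h4⟩
          exact ⟨⟨h1, h4⟩, h2, fun i hi => h3 i (Finset.mem_of_mem_erase hi)⟩
        · rintro ⟨⟨h1, h4⟩, h2, h3⟩
          refine ⟨⟨h1, h2, fun i hi => ?_⟩, h4⟩
          by_cases him : i = m
          · subst him
            refine Submodule.span_le.2 ?_ hc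
            rintro _ ⟨j, hj, rfl⟩
            exact h3 j hj
          · exact h3 i (Finset.mem_erase.2 ⟨him, hi⟩)
      rw [hfil, activitySeries, Finset.mul_sum]
      refine Finset.sum_congr rfl fun B hB => ?_
      have hBs := (mem_basesOn.1 hB).1
      have hle := card_add_card_extActive_le (K := K) (x := x) hBs
      rw [extActive_erase hmin hxm hBs] at hle
      rw [basisSeries, basisSeries, extActive_erase hmin hxm hBs, intActive_erase hmin hBs,
        ← mul_assoc, ← pow_succ']
      congr 2
      omega
    · refine Finset.sum_congr rfl fun B hB => ?_
      have hmB : m ∉ B := fun h => Finset.notMem_erase m S (hsub B hB h)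
      have hmI : m ∉ intActive K x S (insert m B) := by
        rw [mem_intActive_insert_iff hmin hmB]
        intro h
        have hins := (mem_basesOn.1 ((mem_basesOn_contract_iff hm hxm hmB).1 hB)).2.1
        rw [Finset.coe_insert, linearIndepOn_insert (by simpa using hmB)] at hins
        refine hins.2 (Submodule.span_le.2 ?_ hc)
        rintro _ ⟨j, hj, rfl⟩
        exact h j hj
      rw [basisSeries_contract hm hmin hxm (hsub B hB), Finset.erase_eq_of_notMem hmI, basisSeries]
  · have hall : (basesOn K x S).filter (fun B => m ∈ B) = basesOn K x S := by
      refine Finset.filter_true_of_mem fun B hB => ?_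
      by_contra hmB
      obtain ⟨h1, -, h3⟩ := mem_basesOn.1 hB
      exact hc (span_image_mono (Finset.subset_erase.2 ⟨h1, hmB⟩) (h3 m hm))
    rw [activitySeries, ← hall, sum_basesOn_contract hm hxm, activitySeries, activitySeries,
      ← basesOn_contract_of_coloop hc, Finset.mul_sum, ← Finset.sum_add_distrib]
    refine Finset.sum_congr rfl fun B hB => ?_
    have hBs := hsub B hB
    have hmB : m ∉ B := fun h => Finset.notMem_erase m S (hBs h)
    have hins := (mem_basesOn_contract_iff hm hxm hmB).1 hB
    have hle := card_le_finrank_of_mem_basesOn hins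
    have hspan : ∀ i ∈ S.erase m, x i ∈ Submodule.span K (x '' B) := by
      rw [basesOn_contract_of_coloop hc] at hB
      exact (mem_basesOn.1 hB).2.2
    have hmI := (mem_intActive_insert_iff (K := K) hmin hmB).2 hspan
    have hE : extActive K x (S.erase m) B = extActive K x S (insert m B) := by
      rw [← extActive_contract_of_coloop hc hBs, extActive_contract hmin]
    have hmE : m ∉ extActive K x S (insert m B) := fun h =>
      (mem_extActive.1 h).2.1 (Finset.mem_insert_self m B)
    have hI : intActive K x (S.erase m) B = (intActive K x S (insert m B)).erase m := by
      rw [← intActive_contract_of_coloop hc hBs, intActive_contract hmin hBs]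
    rw [basisSeries_contract hm hmin hxm hBs, basisSeries, basisSeries, hE, hI]
    rw [Finset.card_insert_of_notMem hmB] at hle
    -- Splits the sets `I` according to whether they contain `m`.
    conv_lhs => rw [← Finset.insert_erase hmI, Finset.sum_powerset_insert (Finset.notMem_erase m _)]
    rw [mul_add, add_comm]
    congr 1
    rw [Finset.card_insert_of_notMem hmB, mul_left_comm,
      show S.card - (B.card + 1) = (S.erase m).card - B.card by omega]
    congr 1
    · rw [Finset.mul_sum]
      refine Finset.sum_congr rfl fun I hI' => ?_
      have hmI' : m ∉ I := fun h => Finset.notMem_erase m _ (Finset.mem_powerset.1 hI' h)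
      have e1 : (insert m B ∪ extActive K x S (insert m B)) \ insert m I =
          (B ∪ extActive K x S (insert m B)) \ I := by
        ext i
        by_cases him : i = m
        · subst him
          simp [hmB, hmE]
        · simp [him]
      -- Dropping `m` lowers both `|I|` and the rank by one, so the number of variables is
      -- unchanged; the spare power of `X` is the factor in front of the deletion.
      rw [e1, Finset.card_insert_of_notMem hmI', pow_succ', mul_assoc,
        show I.card + 1 + (finrank K U - (B.card + 1)) = I.card + (finrank K U - B.card) by omega]

/-- A loop is externally active for every basis, so `S` and the externally active set both grow by
one and the exponent stays the same. -/
theorem activitySeries_of_eq_zero (hd : IsDegreeBound K x d) (hm : m ∈ S) (hxm : x m = 0) :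
    activitySeries K x S d = activitySeries K x (S.erase m) d := by
  have hbases : basesOn K x S = basesOn K x (S.erase m) := by
    ext B
    rw [mem_basesOn, mem_basesOn, Finset.subset_erase]
    constructor
    · rintro ⟨h1, h2, h3⟩
      exact ⟨⟨h1, fun h => h2.ne_zero h hxm⟩, h2, fun i hi => h3 i (Finset.mem_of_mem_erase hi)⟩
    · rintro ⟨⟨h1, h4⟩, h2, h3⟩
      refine ⟨h1, h2, fun i hi => ?_⟩
      by_cases him : i = m
      · rw [him, hxm]
        exact zero_mem _
      · exact h3 i (Finset.mem_erase.2 ⟨him, hi⟩)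
  rw [activitySeries, activitySeries, hbases]
  refine Finset.sum_congr rfl fun B hB => ?_
  have hmB : m ∉ B := fun h => Finset.notMem_erase m S ((mem_basesOn.1 hB).1 h)
  have hcard := Finset.card_erase_add_one hm
  have hI : intActive K x S B = intActive K x (S.erase m) B := by
    ext b
    rw [mem_intActive, mem_intActive]
    refine and_congr_right fun _ => ⟨fun h i hi => h i (Finset.mem_of_mem_erase hi),
      fun h i hi hx => h i (Finset.mem_erase.2 ⟨?_, hi⟩) hx⟩
    rintro rfl
    exact hx (hxm ▸ zero_mem _)
  have hmE : m ∉ extActive K x (S.erase m) B := fun h =>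
    Finset.notMem_erase m S (mem_extActive.1 h).1
  have hE : extActive K x S B = insert m (extActive K x (S.erase m) B) := by
    ext e
    rw [Finset.mem_insert, mem_extActive, mem_extActive, Finset.mem_erase]
    by_cases hem : e = m
    · subst hem
      simp [hm, hmB, hxm]
    · simp [hem]
  rw [basisSeries, basisSeries, hI, hE, Finset.card_insert_of_notMem hmE]
  congr 1
  · congr 1
    omega
  · refine Finset.sum_congr rfl fun I hI' => ?_
    have hmI : m ∉ I := fun h => hmB (mem_intActive.1 (Finset.mem_powerset.1 hI' h)).1
    have e : (B ∪ insert m (extActive K x (S.erase m) B)) \ I =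
        insert m ((B ∪ extActive K x (S.erase m) B) \ I) := by
      rw [Finset.union_insert, Finset.insert_sdiff_of_notMem _ hmI]
    have hspan : Submodule.span K (x '' (insert m ((B ∪ extActive K x (S.erase m) B) \ I) : Finset ι)) =
        Submodule.span K (x '' ((B ∪ extActive K x (S.erase m) B) \ I : Finset ι)) := by
      rw [Finset.coe_insert, Set.image_insert_eq, hxm, Submodule.span_insert_zero]
    rw [e, le_antisymm (hd.mono _ _ hspan.le) (hd.mono _ _ hspan.ge)]

theorem activitySeries_empty :
    activitySeries K x ∅ d = ∑ j ∈ Finset.range (d ∅),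
      (Nat.multichoose (finrank K U) j : PowerSeries ℕ) * PowerSeries.X ^ j := by
  have hb : basesOn K x ∅ = {∅} := by
    ext B
    rw [mem_basesOn, Finset.mem_singleton, Finset.subset_empty]
    refine ⟨fun h => h.1, ?_⟩
    rintro rfl
    simp
  have hI : intActive K x ∅ ∅ = ∅ := rfl
  have hE : extActive K x ∅ ∅ = ∅ := rfl
  simp [activitySeries, hb, basisSeries, hI, hE]

end ActivitySeries

/-! ### Equality of the Hilbert series and the activity sum. -/

section HilbertSeries

universe v

theorem hilb_prodSpace_eq_activitySeries {K : Type*} [Field K] [Infinite K] {ι : Type*}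
    [LinearOrder ι] {U : Type v} [AddCommGroup U] [Module K U] [FiniteDimensional K U]
    {x : ι → U} (S : Finset ι) {d : Finset ι → ℕ} (hd : IsDegreeBound K x d) :
    hilb (prodSpace K x S d) = activitySeries K x S d := by
  induction hn : S.card generalizing U S d with
  | zero =>
    obtain rfl := Finset.card_eq_zero.1 hn
    rw [prodSpace_empty, hilb_symLT, activitySeries_empty]
  | succ n ih =>
    have hne : S.Nonempty := Finset.card_pos.1 (by omega)
    -- The recursion for the Hilbert series holds for any `m`, but the one for activities uses the
    -- minimum.
    have hm := S.min'_mem hne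
    set m := S.min' hne
    have hcard : (S.erase m).card = n := by rw [Finset.card_erase_of_mem hm, hn]; rfl
    by_cases hxm : x m = 0
    · rw [← prodSpace_erase_of_eq_zero hd hm hxm, activitySeries_of_eq_zero hd hm hxm,
        ih _ hd hcard]
    · rw [hilb_prodSpace hd hm hxm, activitySeries_of_ne_zero hm (fun i hi => S.min'_le i hi) hxm,
        ih _ hd hcard, ih _ (hd.contract m) hcard]

end HilbertSeries

/-! ### Translation to the linear matroid, its flats and `χ`. -/

section Comparison

universe v

variable {K : Type*} [Field K] {U : Type v} [AddCommGroup U] [Module K U]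
variable {ι : Type*} {x : ι → U}

theorem closure_subset_iff [Finite ι] (A B : Set ι) :
    (linearMatroid K x).closure A ⊆ (linearMatroid K x).closure B ↔
      Submodule.span K (x '' A) ≤ Submodule.span K (x '' B) := by
  constructor
  · intro h
    refine Submodule.span_le.2 ?_
    rintro _ ⟨i, hi, rfl⟩
    exact (mem_closure_linearMatroid_iff x B i).1
      (h ((mem_closure_linearMatroid_iff x A i).2 (Submodule.subset_span ⟨i, hi, rfl⟩)))
  · intro h i hi
    exact (mem_closure_linearMatroid_iff x B i).2 (h ((mem_closure_linearMatroid_iff x A i).1 hi))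

theorem chi_le_one [Finite ι] (J : Set (Flats K x)) (A : Set ι) : chi J A ≤ 1 := by
  rw [chi]
  split_ifs <;> omega

theorem chi_mono [Finite ι] {J : Set (Flats K x)} (hJ : IsUpperSet J) {A B : Set ι}
    (h : Submodule.span K (x '' A) ≤ Submodule.span K (x '' B)) : chi J A ≤ chi J B := by
  rw [chi, chi]
  split_ifs with h1 h2
  · exact le_rfl
  · exact absurd (hJ (show clos K x A ≤ clos K x B from (closure_subset_iff A B).2 h) h1) h2
  · exact zero_le_one
  · exact le_rfl

theorem chi_eq_one_of_span_eq_top [Finite ι] {J : Set (Flats K x)} (hJ : IsUpperSet J)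
    (hne : J.Nonempty) {A : Set ι} (hA : Submodule.span K (x '' A) = ⊤) : chi J A = 1 := by
  obtain ⟨F, hF⟩ := hne
  refine if_pos (hJ (show F ≤ clos K x A from fun i _ => ?_) hF)
  exact (mem_closure_linearMatroid_iff x A i).2 (hA ▸ Submodule.mem_top)

theorem isDegreeBound_chi_add [Finite ι] {J : Set (Flats K x)} (hJ : IsUpperSet J) (k : ℕ) :
    IsDegreeBound K x (fun A => chi J (A : Set ι) + k) where
  mono A B h := Nat.add_le_add_right (chi_mono hJ h) k
  le_add_one A B := by
    have := chi_le_one J (A : Set ι)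
    omega

/-- The strict bound `deg f < χ + k` treats all `k` uniformly: for `k = 0` it leaves only scalars
when `χ = 1` and nothing when `χ = 0`. -/
theorem pSpace_eq_prodSpace [Fintype ι] [DecidableEq ι] (J : Set (Flats K x)) (k : ℕ) :
    pSpace J k = prodSpace K x Finset.univ (fun A => chi J (A : Set ι) + k) := by
  have hcompl : ∀ Y : Finset ι, ((Finset.univ \ Y : Finset ι) : Set ι) = (Y : Set ι)ᶜ := by
    intro Y
    rw [← Finset.compl_eq_univ_sdiff, Finset.coe_compl]
  apply le_antisymm <;> refine Submodule.span_le.2 ?_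
  · cases k with
    | zero =>
      rintro _ ⟨Y, hY, rfl⟩
      rw [← one_mul (pProd K x Y)]
      refine mul_pProd_mem_prodSpace (Finset.subset_univ Y) ?_
      rw [hcompl, chi, if_pos hY]
      simpa using mem_symLT_of_mem_symDegree one_pos (algebraMap_mem_symDegree (U := U) (1 : K))
    | succ n =>
      rintro _ ⟨Y, f, -, hf, rfl⟩
      refine mul_pProd_mem_prodSpace (Finset.subset_univ Y) ?_
      rw [hcompl, ← add_assoc, ← symDegreeLE_eq_symLT]
      exact hf
  · rintro _ ⟨Y, -, f, hf, rfl⟩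
    replace hf : f ∈ symLT K U (chi J ((Finset.univ \ Y : Finset ι) : Set ι) + k) := hf
    rw [hcompl] at hf
    by_cases hf0 : f = 0
    · rw [hf0, zero_mul]
      exact zero_mem _
    cases k with
    | zero =>
      by_cases hY : clos K x ((Y : Set ι)ᶜ) ∈ J
      · rw [chi, if_pos hY, add_zero, ← zero_add 1, ← symDegreeLE_eq_symLT] at hf
        have hf' : f ∈ symDegree K U 0 := by simpa [symDegreeLE] using hf
        rw [symDegree, pow_zero] at hf'
        obtain ⟨r, rfl⟩ := Submodule.mem_one.1 hf'
        rw [← Algebra.smul_def]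
        exact Submodule.smul_mem _ r (Submodule.subset_span ⟨Y, hY, rfl⟩)
      · rw [chi, if_neg hY, add_zero, symLT_zero, Submodule.mem_bot] at hf
        exact absurd hf hf0
    | succ n =>
      rw [← add_assoc, ← symDegreeLE_eq_symLT] at hf
      exact Submodule.subset_span ⟨Y, f, hf0, hf, rfl⟩

theorem bases_eq_basesOn_univ [Fintype ι] : bases K x = basesOn K x Finset.univ := by
  ext B
  rw [mem_basesOn]
  simp only [bases, Finset.mem_filter, Matroid.isBase_iff_indep_closure_eq,
    Finset.mem_univ, true_and, Finset.subset_univ, forall_const]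
  rw [linearMatroid_indep_iff, linearMatroid_ground, Set.eq_univ_iff_forall]
  simp only [mem_closure_linearMatroid_iff]

theorem internallyActive_eq_intActive [Fintype ι] [LinearOrder ι] {B : Finset ι}
    (hB : B ∈ basesOn K x Finset.univ) :
    internallyActive K x B = intActive K x Finset.univ B := by
  ext b
  rw [mem_intActive]
  simp only [internallyActive, Finset.mem_filter]
  refine and_congr_right fun hb => ?_
  have hind : b ∈ ((linearMatroid K x).closure ((B : Set ι) \ {b}))ᶜ := by
    rw [Set.mem_compl_iff, mem_closure_linearMatroid_iff]
    exact LinearIndepOn.notMem_span_of_insert (by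
      rw [Set.insert_sdiff_singleton, Set.insert_eq_of_mem (by exact_mod_cast hb)]
      exact (mem_basesOn.1 hB).2.1) (by simp)
  rw [IsGreatest, and_iff_right hind, mem_upperBounds]
  simp only [Set.mem_compl_iff, mem_closure_linearMatroid_iff, Finset.mem_univ, forall_const,
    Finset.coe_erase]

theorem externallyActive_eq_extActive [Fintype ι] [LinearOrder ι] (B : Finset ι) :
    externallyActive K x B = extActive K x Finset.univ B := by
  ext e
  rw [mem_extActive]
  simp only [externallyActive, Finset.mem_filter, mem_closure_linearMatroid_iff, Finset.coe_filter]

theorem card_eq_finrank_of_mem_basesOn_univ [Fintype ι]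
    (hx : Submodule.span K (Set.range x) = ⊤) {B : Finset ι}
    (hB : B ∈ basesOn K x Finset.univ) :
    Submodule.span K (x '' B) = ⊤ ∧ B.card = finrank K U := by
  have h := mem_basesOn.1 hB
  have hspan : Submodule.span K (x '' B) = ⊤ := by
    rw [← top_le_iff, ← hx, Submodule.span_le]
    rintro _ ⟨i, rfl⟩
    exact h.2.2 i (Finset.mem_univ i)
  refine ⟨hspan, ?_⟩
  have h2 := finrank_span_eq_card (R := K) (b := fun i : (B : Set ι) => x i) h.2.1
  rw [← Set.image_eq_range, hspan, finrank_top] at h2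
  simpa using h2.symm

theorem basisSeries_eq [Fintype ι] [LinearOrder ι] (hx : Submodule.span K (Set.range x) = ⊤)
    {J : Set (Flats K x)} (hJ : IsUpperSet J) (hJne : J.Nonempty) (k : ℕ) {B : Finset ι}
    (hB : B ∈ basesOn K x Finset.univ) :
    basisSeries K x Finset.univ (fun A => chi J (A : Set ι) + k) B =
      (PowerSeries.X : PowerSeries ℕ) ^
          (Fintype.card ι - finrank K U - (externallyActive K x B).card) *
        (1 + ∑ I ∈ (internallyActive K x B).powerset with I.Nonempty,
          ∑ j ∈ Finset.range (chi J (((B ∪ externallyActive K x B) \ I : Finset ι) : Set ι) + k),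
            (PowerSeries.X : PowerSeries ℕ) ^ (I.card + j) *
              (Nat.choose (j + I.card - 1) (I.card - 1) : PowerSeries ℕ)) := by
  obtain ⟨hspan, hcard⟩ := card_eq_finrank_of_mem_basesOn_univ hx hB
  rw [basisSeries, ← externallyActive_eq_extActive, ← internallyActive_eq_intActive hB, hcard,
    Finset.card_univ, Nat.sub_self]
  congr 1
  rw [← Finset.sum_filter_add_sum_filter_not _ (fun I : Finset ι => I.Nonempty), add_comm]
  congr 1
  · have hfil : (internallyActive K x B).powerset.filter (fun I => ¬ I.Nonempty) = {∅} := by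
      ext I
      simp only [Finset.mem_filter, Finset.mem_powerset, Finset.not_nonempty_iff_eq_empty,
        Finset.mem_singleton]
      refine ⟨fun h => h.2, ?_⟩
      rintro rfl
      exact ⟨Finset.empty_subset _, rfl⟩
    have hchi : chi J (((B ∪ externallyActive K x B) \ ∅ : Finset ι) : Set ι) = 1 := by
      refine chi_eq_one_of_span_eq_top hJ hJne (top_le_iff.1 (hspan ▸ span_image_mono ?_))
      rw [Finset.sdiff_empty]
      exact Finset.subset_union_left
    -- For `I = ∅` there are no variables, so only `j = 0` contributes; it is in range because `χ =
    -- 1` on a spanning set, and it gives the summand `1`.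
    rw [hfil, Finset.sum_singleton, hchi, add_comm 1 k, Finset.sum_range_succ']
    simp
  · refine Finset.sum_congr rfl fun I hI => ?_
    have hpos : 0 < I.card := Finset.card_pos.2 (Finset.mem_filter.1 hI).2
    rw [Finset.mul_sum]
    refine Finset.sum_congr rfl fun j _ => ?_
    rw [add_zero, Nat.multichoose_eq, pow_add, mul_comm (Nat.cast _), mul_assoc, add_comm j]
    rw [Nat.choose_symm_of_eq_add (show I.card + j - 1 = j + (I.card - 1) by omega)]

end Comparison

end

end Zonotopal

open Zonotopal in
theorem mainTheorem7
    {K : Type*} [Field K] [CharZero K]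
    {U : Type*} [AddCommGroup U] [Module K U] [FiniteDimensional K U]
    (hr : 1 ≤ Module.finrank K U)
    {ι : Type*} [Fintype ι] [LinearOrder ι] (x : ι → U)
    (hx : Submodule.span K (Set.range x) = ⊤)
    (J : Set (Flats K x)) (hJ : IsUpperSet J) (hJne : J.Nonempty) :
    (∀ k : ℕ, IsGradedSubspace (pSpace J k) ∧
      hilb (pSpace J k) =
        ∑ B ∈ bases K x,
          (PowerSeries.X : PowerSeries ℕ) ^
              (Fintype.card ι - Module.finrank K U - (externallyActive K x B).card) *
            (1 + ∑ I ∈ (internallyActive K x B).powerset with I.Nonempty,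
              ∑ j ∈ Finset.range (chi J (((B ∪ externallyActive K x B) \ I : Finset ι) : Set ι) + k),
                (PowerSeries.X : PowerSeries ℕ) ^ (I.card + j) *
                  (Nat.choose (j + I.card - 1) (I.card - 1) : PowerSeries ℕ))) ∧
    hilb (pSpace J 0) =
      ∑ B ∈ bases K x,
        (PowerSeries.X : PowerSeries ℕ) ^
            (Fintype.card ι - Module.finrank K U - (externallyActive K x B).card) *
          (1 + ∑ I ∈ (internallyActive K x B).powerset with
              I.Nonempty ∧ chi J (((B ∪ externallyActive K x B) \ I : Finset ι) : Set ι) = 1,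
            (PowerSeries.X : PowerSeries ℕ) ^ I.card) := by

  have key : ∀ k : ℕ, IsGradedSubspace (pSpace J k) ∧
      hilb (pSpace J k) =
        ∑ B ∈ bases K x,
          (PowerSeries.X : PowerSeries ℕ) ^
              (Fintype.card ι - Module.finrank K U - (externallyActive K x B).card) *
            (1 + ∑ I ∈ (internallyActive K x B).powerset with I.Nonempty,
              ∑ j ∈ Finset.range (chi J (((B ∪ externallyActive K x B) \ I : Finset ι) : Set ι) + k),
                (PowerSeries.X : PowerSeries ℕ) ^ (I.card + j) *
                  (Nat.choose (j + I.card - 1) (I.card - 1) : PowerSeries ℕ)) := by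
    intro k
    rw [pSpace_eq_prodSpace]
    refine ⟨isGradedSubspace_of_symComp_mem fun f hf i => symComp_mem_prodSpace hf i, ?_⟩
    rw [hilb_prodSpace_eq_activitySeries _ (isDegreeBound_chi_add hJ k), activitySeries,
      bases_eq_basesOn_univ]
    exact Finset.sum_congr rfl fun B hB => basisSeries_eq hx hJ hJne k hB
  refine ⟨key, (key 0).2.trans (Finset.sum_congr rfl fun B _ => ?_)⟩
  -- For `k = 0` the inner sum has `χ ∈ {0, 1}` terms, so it is either `X ^ |I|` or empty.
  rw [← Finset.filter_filter, Finset.sum_filter (fun I => chi J _ = 1)]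
  congr 2
  refine Finset.sum_congr rfl fun I _ => ?_
  have := chi_le_one J (((B ∪ externallyActive K x B) \ I : Finset ι) : Set ι)
  split_ifs with h
  · rw [h]
    simp
  · rw [show chi J (((B ∪ externallyActive K x B) \ I : Finset ι) : Set ι) = 0 by omega]
    simp
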